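/- **Theorem D.** Let $\mathbb N=\{1,2,3,\dots\}$. An *odometer system* $(X,\mu,f)$ consists of a space $X=\prod_{n\ge1}A_n$ with $A_n=\{0,\dots,\alpha_n-1\}$, $\alpha_n\ge2$, the map $f:X\to X$ "add $1$ to the first coordinate and carry to the right" (the point $(\alpha_1-1,\alpha_2-1,\dots)$ is sent to $(0,0,\dots)$), and a product probability $\mu=\prod_n\mu_n$ on the Borel sets, where $\mu_n$ is a probability on $A_n$ with $\mu_n(a)>0$ for all $a\in A_n$ and $\prod_n\max_{a}\mu_n(a)=0$ (so $\mu$ is non-atomic). There exists an odometer system $(X,\mu,f)$ such that $f$ is non-singular and, for $\mathbb K=\mathbb R$ or $\mathbb C$ and every $1\le p<\infty$, the composition operator $T_f\varphi=\varphi\circ f$ is a well-defined continuous linear operator on $L^p(X,\mu;\mathbb K)$ which is mixing, distributionally chaotic and Devaney chaotic; moreover, if $p\ge2$, then $T_f$ does not satisfy the Frequent Hypercyclicity Criterion. Explicitly, one can take $X=\{0,1\}^{\mathbb N}$ with $\mu_n(1)=2^{-n}$ if $n\notin\{4^k:k\ge1\}$, $\mu_{4^k}(1)=\frac1{k+1}$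 for $k\ge1$, and $\mu_n(0)=1-\mu_n(1)$; the system does not depend on $p$ or $\mathbb K$. Here a continuous linear operator $T$ on a Banach space $E$ is: *mixing* if for all nonempty open $U,V\subseteq E$ there is $n_0$ with $T^n(U)\cap V\ne\varnothing$ for all $n\ge n_0$; *Devaney chaotic* if $\{T^nx:n\ge1\}$ is dense for some $x\in E$ and the periodic points of $T$ are dense; *distributionally chaotic* if there are $x\in E$ and sets $D,F\subseteq\mathbb N$ of upper density $1$ with $\|T^nx\|\to0$ along $D$ and $\|T^nx\|\to\infty$ along $F$. It satisfies the *Frequent Hypercyclicity Criterion* if there are a dense set $X_0\subseteq E$ and a map $S:X_0\to X_0$ such that for every $x\in X_0$ the series $\sum_nT^nx$ and $\sum_nS^nx$ converge unconditionally and $TSx=x$. -/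

import Mathlib

open MeasureTheory Filter Topology
open scoped ENNReal

namespace LinearDynamics

section Operators

variable {𝕜 E : Type*} [RCLike 𝕜] [NormedAddCommGroup E] [NormedSpace 𝕜 E]

/-- `T` is hypercyclic: some orbit `{T x, T² x, …}` is dense. -/
def IsHypercyclic (T : E →L[𝕜] E) : Prop :=
  ∃ x : E, Dense {y : E | ∃ n : ℕ, 1 ≤ n ∧ (⇑T)^[n] x = y}

/-- `T` is Devaney chaotic: it is hypercyclic and its periodic points are dense. -/
def IsDevaneyChaotic (T : E →L[𝕜] E) : Prop :=
  IsHypercyclic T ∧ Dense (Function.periodicPts (⇑T))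

/-- `T` is (topologically) mixing. -/
def IsMixing (T : E →L[𝕜] E) : Prop :=
  ∀ U V : Set E, IsOpen U → IsOpen V → U.Nonempty → V.Nonempty →
    ∃ n₀ : ℕ, ∀ n : ℕ, n₀ ≤ n → ((⇑T)^[n] '' U ∩ V).Nonempty

/-- The upper density of a set of positive integers (the element `0`, if present, is not
counted). The quotients lie in `[0, 1]`, so the real `limsup` is a genuine one. -/
noncomputable def upperDensity (A : Set ℕ) : ℝ :=
  limsup (fun N : ℕ => ((Set.Icc 1 N ∩ A).ncard : ℝ) / (N : ℝ)) atTop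

/-- `T` is distributionally chaotic: it has a vector whose orbit tends to `0` in norm along a set
of upper density one and to `∞` in norm along another set of upper density one. -/
def IsDistributionallyChaotic (T : E →L[𝕜] E) : Prop :=
  ∃ (x : E) (D F : Set ℕ), upperDensity D = 1 ∧ upperDensity F = 1 ∧
    Tendsto (fun n : ℕ => ‖(⇑T)^[n] x‖) (atTop ⊓ 𝓟 D) (𝓝 0) ∧
    Tendsto (fun n : ℕ => ‖(⇑T)^[n] x‖) (atTop ⊓ 𝓟 F) atTop

/-- `T` satisfies the Frequent Hypercyclicity Criterion: there are a dense set `X₀` and a map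
`S : X₀ → X₀` (not assumed linear or continuous) such that for every `x ∈ X₀` the series
`∑ Tⁿ x` and `∑ Sⁿ x` converge unconditionally and `T (S x) = x`. -/
def SatisfiesFHC (T : E →L[𝕜] E) : Prop :=
  ∃ X₀ : Set E, Dense X₀ ∧ ∃ S : X₀ → X₀, ∀ x : X₀,
    Summable (fun n : ℕ => (⇑T)^[n] (x : E)) ∧
    Summable (fun n : ℕ => ((S^[n] x : X₀) : E)) ∧
    T (S x : E) = (x : E)

end Operators

/-- The data of an odometer system. Coordinates are indexed by `ℕ`, so the entry with index `n`
is the `(n+1)`-st coordinate of the usual indexing by `1, 2, 3, …`. The last field says that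
`∏ₙ max {νₙ(a) : a} = 0`. -/
structure OdometerSystem where
  /-- the number of digits in each coordinate -/
  α : ℕ → ℕ
  two_le : ∀ n, 2 ≤ α n
  /-- the probability measure on the digits of each coordinate -/
  ν : ∀ n, Measure (Fin (α n))
  prob : ∀ n, IsProbabilityMeasure (ν n)
  pos : ∀ n (a : Fin (α n)), 0 < ν n {a}
  nonatomic : Tendsto (fun N : ℕ => ∏ n ∈ Finset.range N, ⨆ a : Fin (α n), ν n {a}) atTop (𝓝 0)

namespace OdometerSystem

attribute [instance] OdometerSystem.prob

/-- The underlying space `∏ₙ {0, …, αₙ - 1}` (its product σ-algebra is its Borel σ-algebra). -/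
abbrev Space (S : OdometerSystem) : Type := ∀ n, Fin (S.α n)

/-- The product probability measure `∏ₙ νₙ`. -/
noncomputable def measure (S : OdometerSystem) : Measure S.Space :=
  Measure.infinitePi S.ν

/-- The odometer: add one to the first coordinate and carry to the right. A coordinate is
increased by one (modulo `αₙ`) exactly when all earlier coordinates are maximal; in particular
the point all of whose coordinates are maximal is sent to `(0, 0, 0, …)`. -/
def map (S : OdometerSystem) (x : S.Space) : S.Space := fun n =>
  if ∀ j < n, (x j : ℕ) + 1 = S.α j then
    ⟨((x n : ℕ) + 1) % S.α n, Nat.mod_lt _ (lt_of_lt_of_le two_pos (S.two_le n))⟩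
  else x n

end OdometerSystem

/-- `T` is the composition operator `φ ↦ φ ∘ f` on `L^p(μ)`. -/
def IsCompositionOperator {X 𝕜 : Type*} [MeasurableSpace X] [RCLike 𝕜] {μ : Measure X}
    {p : ℝ≥0∞} [Fact (1 ≤ p)] (f : X → X) (T : Lp 𝕜 p μ →L[𝕜] Lp 𝕜 p μ) : Prop :=
  ∀ φ : Lp 𝕜 p μ, (T φ : X → 𝕜) =ᵐ[μ] (φ : X → 𝕜) ∘ f

end LinearDynamics

/-!
The system is the odometer `f` on `{0,1}^ℕ` with the prescribed digit laws. What matters is that the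
digits are `0` with probability tending to `1`, that `μ` has no atoms, and that the masses of the
cylinders on which `f` carries are at most `8` times those of their images. The last fact bounds
the image of `μ` under `f` by `8 • μ` (`OdometerSystem.map_measure_le`), so `T φ = φ ∘ f` is bounded
on `L^p`.

*Periodic points.* A function of the first `N` coordinates is invariant under `f^q`, where `q` is
the number of values of these coordinates. Such functions are dense in `L^p` and bounded, which
makes them the natural vectors to perturb (`boundedPeriodic`).

*Mixing and distributional chaos.* If the coordinates of `x` vanish on a block `[m, M)`, then for
`place m ≤ n ≤ place M - place m` those of `fⁿ x` do not all vanish there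
(`OdometerSystem.preimage_iterate_zeroBlock_subset`). So the set `B` of points vanishing on the
block has almost full measure, while `f⁻ⁿ B` is almost null. Redefining a bounded function off `B`
changes it little, but prescribes its image under `Tⁿ` up to a small error; this gives mixing, and
hypercyclicity follows by Baire's theorem. Taking long blocks, the times `n` fill most of an
interval `[1, N]`: the restriction to `B` of a bounded function has small norm along its orbit at
these times, and the indicator of `Bᶜ`, small in norm, has large relative growth. A generic vector
is then distributionally irregular (`IsDistributionallyChaotic.of_dense`).

*Failure of the Frequent Hypercyclicity Criterion.* For `p ≥ 2`, Clarkson's inequality shows that an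
unconditionally convergent series `∑ Tⁿ φ` satisfies `∑ ‖Tⁿ φ‖ ^ p < ∞`
(`Lp.summable_norm_rpow`). Hence `∑ μ (f⁻ⁿ A) < ∞` for each `A = {δ ≤ |φ|}`, and by Borel–Cantelli
almost every orbit visits `A` finitely often. But `f` is conservative, because `μ` has no atoms
(`OdometerSystem.conservative`): the points of a set without returns are determined by their tails,
so its measure is at most the largest mass of a cylinder of length `N`, for every `N`. Thus `φ = 0`.
-/

namespace LinearDynamics

/-! ### Transitivity and hypercyclicity -/

section Transitivity

variable {𝕜 E : Type*} [RCLike 𝕜] [NormedAddCommGroup E] [NormedSpace 𝕜 E]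

/-- Birkhoff's transitivity theorem, for mixing operators: the vectors with dense orbit form a
countable intersection of dense open sets. -/
theorem IsMixing.isHypercyclic [CompleteSpace E] [SecondCountableTopology E] {T : E →L[𝕜] E}
    (hT : IsMixing T) : IsHypercyclic T := by
  have hc := TopologicalSpace.countable_countableBasis E
  have hcont (n : ℕ) : Continuous (⇑T)^[n] := T.continuous.iterate n
  have hd : Dense (⋂ V ∈ TopologicalSpace.countableBasis E,
      ⋃ n ≥ 1, (⇑T)^[n] ⁻¹' V) := by
    refine dense_biInter_of_isOpen (fun V hV => ?_) hc (fun V hV => ?_)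
    · exact isOpen_biUnion fun n _ =>
        (TopologicalSpace.isOpen_of_mem_countableBasis hV).preimage (hcont n)
    · rw [dense_iff_inter_open]
      intro U hU hUne
      obtain ⟨n₀, hn₀⟩ := hT U V hU (TopologicalSpace.isOpen_of_mem_countableBasis hV) hUne
        (TopologicalSpace.nonempty_of_mem_countableBasis hV)
      obtain ⟨_, ⟨u, hu, rfl⟩, huV⟩ := hn₀ (n₀ + 1) (by omega)
      exact ⟨u, hu, Set.mem_biUnion (show n₀ + 1 ≥ 1 by omega) huV⟩
  obtain ⟨x, hx⟩ := hd.nonempty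
  refine ⟨x, (TopologicalSpace.isBasis_countableBasis E).dense_iff.2 fun V hV _ => ?_⟩
  obtain ⟨n, hn, hxn⟩ := Set.mem_iUnion₂.1 (Set.mem_iInter₂.1 hx V hV)
  exact ⟨_, hxn, n, hn, rfl⟩

end Transitivity

/-! ### Upper density -/

section Density

theorem upperDensity_quotient_le_one (A : Set ℕ) (N : ℕ) :
    ((Set.Icc 1 N ∩ A).ncard : ℝ) / (N : ℝ) ≤ 1 := by
  refine div_le_one_of_le₀ ?_ (Nat.cast_nonneg N)
  have h := Set.ncard_le_ncard (Set.inter_subset_left (s := Set.Icc 1 N) (t := A))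
    (Set.finite_Icc 1 N)
  rw [Set.ncard_Icc_nat] at h
  exact_mod_cast (by omega : (Set.Icc 1 N ∩ A).ncard ≤ N)

/-- If `A r` decreases with `r` and has proportion at least `1 - 1 / (r + 1)` in some `[1, N]` with
`N > r`, then some set of upper density one is almost contained in every `A r`.
It is glued from the pieces of the `A k` on consecutive blocks `(N k, N (k + 1)]`, each much longer
than everything before it. -/
theorem exists_upperDensity_eq_one {A : ℕ → Set ℕ} (hA : Antitone A)
    (h : ∀ r : ℕ, ∃ N : ℕ, r < N ∧
      (1 - 1 / ((r : ℝ) + 1)) * N ≤ ((Set.Icc 1 N ∩ A r).ncard : ℝ)) :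
    ∃ D : Set ℕ, upperDensity D = 1 ∧ ∀ r, ∀ᶠ n in atTop ⊓ 𝓟 D, n ∈ A r := by
  choose M hMlt hM using h
  obtain ⟨N, hN⟩ : ∃ N : ℕ → ℕ, ∀ k, N (k + 1) = M ((k + 1) * (N k + 1)) :=
    ⟨fun k => Nat.rec (motive := fun _ => ℕ) 0 (fun k Nk => M ((k + 1) * (Nk + 1))) k,
      fun _ => rfl⟩
  have hNlt (k : ℕ) : (k + 1) * (N k + 1) < N (k + 1) := by rw [hN]; exact hMlt _
  have hNmono : StrictMono N := strictMono_nat_of_lt_succ fun k => by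
    have := hNlt k; nlinarith
  let D : Set ℕ := {n | ∃ k, N k < n ∧ n ≤ N (k + 1) ∧ n ∈ A k}
  refine ⟨D, le_antisymm ?_ ?_, fun r => ?_⟩
  · refine limsup_le_of_le ?_ (Eventually.of_forall fun N => upperDensity_quotient_le_one D N)
    exact IsCoboundedUnder.of_frequently_ge (a := 0)
      (Frequently.of_forall fun N => by positivity)
  · have hbd : IsBoundedUnder (· ≤ ·) atTop
        (fun N : ℕ => ((Set.Icc 1 N ∩ D).ncard : ℝ) / (N : ℝ)) :=
      isBoundedUnder_of ⟨1, fun N => upperDensity_quotient_le_one D N⟩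
    have key (k : ℕ) : 1 - 2 / ((k : ℝ) + 1) ≤
        ((Set.Icc 1 (N (k + 1)) ∩ D).ncard : ℝ) / (N (k + 1) : ℝ) := by
      have hsub : Set.Icc 1 (N (k + 1)) ∩ A ((k + 1) * (N k + 1)) ⊆
          (Set.Icc 1 (N (k + 1)) ∩ D) ∪ Set.Icc 1 (N k) := by
        rintro n ⟨⟨h1, h2⟩, h3⟩
        rcases le_or_gt n (N k) with h4 | h4
        · exact Or.inr ⟨h1, h4⟩
        · refine Or.inl ⟨⟨h1, h2⟩, k, h4, h2, hA ?_ h3⟩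
          nlinarith
      have hcard := (Set.ncard_le_ncard hsub (((Set.finite_Icc _ _).inter_of_left _).union
        (Set.finite_Icc _ _))).trans (Set.ncard_union_le _ _)
      rw [Set.ncard_Icc_nat, Nat.add_sub_cancel] at hcard
      have hcard' : ((Set.Icc 1 (N (k + 1)) ∩ A ((k + 1) * (N k + 1))).ncard : ℝ) ≤
          ((Set.Icc 1 (N (k + 1)) ∩ D).ncard : ℝ) + (N k : ℝ) := by exact_mod_cast hcard
      have hMk := hM ((k + 1) * (N k + 1))
      rw [← hN] at hMk
      have hpos : (0 : ℝ) < N (k + 1) := by exact_mod_cast (Nat.zero_le _).trans_lt (hNlt k)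
      have hk : (0 : ℝ) < (k : ℝ) + 1 := by positivity
      have h1 : 1 / ((((k + 1) * (N k + 1) : ℕ) : ℝ) + 1) ≤ 1 / ((k : ℝ) + 1) := by
        apply one_div_le_one_div_of_le hk
        have : k + 1 ≤ (k + 1) * (N k + 1) + 1 := by nlinarith
        exact_mod_cast this
      have h2 : (N k : ℝ) ≤ 1 / ((k : ℝ) + 1) * N (k + 1) := by
        rw [one_div, inv_mul_eq_div, le_div_iff₀ hk]
        have : N k * (k + 1) ≤ N (k + 1) := by have := hNlt k; nlinarith
        exact_mod_cast this
      rw [le_div_iff₀ hpos]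
      have h3 := mul_le_mul_of_nonneg_right h1 hpos.le
      have h4 : 2 / ((k : ℝ) + 1) = 1 / ((k : ℝ) + 1) + 1 / ((k : ℝ) + 1) := by ring
      rw [h4]
      linarith
    refine le_of_forall_lt fun b hb => ?_
    obtain ⟨b', hb', hb'1⟩ := exists_between hb
    refine hb'.trans_le (le_limsup_of_frequently_le ?_ hbd)
    have hlim : Tendsto (fun k : ℕ => 1 - 2 / ((k : ℝ) + 1)) atTop (𝓝 1) := by
      have := (tendsto_one_div_add_atTop_nhds_zero_nat (𝕜 := ℝ)).const_mul 2
      simpa [div_eq_mul_inv] using this.const_sub 1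
    have hev : ∀ᶠ k : ℕ in atTop, b' ≤
        ((Set.Icc 1 (N (k + 1)) ∩ D).ncard : ℝ) / (N (k + 1) : ℝ) := by
      filter_upwards [hlim.eventually (lt_mem_nhds hb'1)] with k hk
      exact hk.le.trans (key k)
    have hNt : Tendsto (fun k => N (k + 1)) atTop atTop :=
      hNmono.tendsto_atTop.comp (tendsto_add_atTop_nat 1)
    exact hNt.frequently hev.frequently
  · rw [eventually_inf_principal]
    filter_upwards [eventually_gt_atTop (N r)] with n hn
    rintro ⟨k, hk1, hk2, hk3⟩
    refine hA ?_ hk3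
    by_contra hlt
    have := hNmono.monotone (show k + 1 ≤ r by omega)
    omega

/-- Being in the open set `O n` for a given proportion of the times `n ∈ [1, N]` is an open
condition. -/
theorem isOpen_setOf_le_ncard {E : Type*} [TopologicalSpace E] {O : ℕ → Set E}
    (hO : ∀ n, IsOpen (O n)) (N : ℕ) (a : ℝ) :
    IsOpen {x | a ≤ ((Set.Icc 1 N ∩ {n | x ∈ O n}).ncard : ℝ)} := by
  rw [isOpen_iff_mem_nhds]
  intro x hx
  have hfin : (Set.Icc 1 N ∩ {n | x ∈ O n}).Finite := (Set.finite_Icc _ _).inter_of_left _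
  filter_upwards [(hfin.isOpen_biInter fun n _ => hO n).mem_nhds
    (Set.mem_iInter₂.2 fun n hn => hn.2)] with y hy
  have hsub : Set.Icc 1 N ∩ {n | x ∈ O n} ⊆ Set.Icc 1 N ∩ {n | y ∈ O n} :=
    fun n hn => ⟨hn.1, Set.mem_iInter₂.1 hy n hn⟩
  exact le_trans (Set.mem_ofPred.1 hx) (Nat.cast_le.2
    (Set.ncard_le_ncard hsub ((Set.finite_Icc _ _).inter_of_left _)))

end Density

/-! ### Distributional chaos by Baire category -/

section DistributionalChaos

variable {𝕜 E : Type*} [RCLike 𝕜] [NormedAddCommGroup E] [NormedSpace 𝕜 E]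

/-- If the vectors whose orbit is small (resp. large) during most of some long time interval are
dense, then a generic vector is distributionally irregular. -/
theorem IsDistributionallyChaotic.of_dense [CompleteSpace E] {T : E →L[𝕜] E}
    (hsmall : ∀ r : ℕ, Dense {x : E | ∃ N : ℕ, r < N ∧ (1 - 1 / ((r : ℝ) + 1)) * N ≤
      ((Set.Icc 1 N ∩ {n | ‖(⇑T)^[n] x‖ < 1 / ((r : ℝ) + 1)}).ncard : ℝ)})
    (hlarge : ∀ r : ℕ, Dense {x : E | ∃ N : ℕ, r < N ∧ (1 - 1 / ((r : ℝ) + 1)) * N ≤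
      ((Set.Icc 1 N ∩ {n | (r : ℝ) < ‖(⇑T)^[n] x‖}).ncard : ℝ)}) :
    IsDistributionallyChaotic T := by
  have hcont (n : ℕ) : Continuous fun x => ‖(⇑T)^[n] x‖ := (T.continuous.iterate n).norm
  have ho (O : ℕ → Set E) (hO : ∀ n, IsOpen (O n)) (r : ℕ) :
      IsOpen {x : E | ∃ N : ℕ, r < N ∧ (1 - 1 / ((r : ℝ) + 1)) * N ≤
        ((Set.Icc 1 N ∩ {n | x ∈ O n}).ncard : ℝ)} := by
    simp only [Set.ofPred_exists, Set.ofPred_and]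
    exact isOpen_iUnion fun N => isOpen_const.inter (isOpen_setOf_le_ncard hO N _)
  have ho1 (r : ℕ) := ho (fun n => {x | ‖(⇑T)^[n] x‖ < 1 / ((r : ℝ) + 1)})
    (fun n => isOpen_lt (hcont n) continuous_const) r
  have ho2 (r : ℕ) := ho (fun n => {x | (r : ℝ) < ‖(⇑T)^[n] x‖})
    (fun n => isOpen_lt continuous_const (hcont n)) r
  obtain ⟨x, hx⟩ := (dense_iInter_of_isOpen_nat
    (fun r => (ho1 r).inter (ho2 r))
    (fun r => (hsmall r).inter_of_isOpen_left (hlarge r) (ho1 r))).nonempty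
  rw [Set.mem_iInter] at hx
  obtain ⟨D, hD, hxD⟩ := exists_upperDensity_eq_one
    (A := fun r : ℕ => {n | ‖(⇑T)^[n] x‖ < 1 / ((r : ℝ) + 1)})
    (fun r s hrs n hn => lt_of_lt_of_le (Set.mem_ofPred.1 hn) (Nat.one_div_le_one_div hrs))
    (fun r => (hx r).1)
  obtain ⟨F, hF, hxF⟩ := exists_upperDensity_eq_one
    (A := fun r : ℕ => {n | (r : ℝ) < ‖(⇑T)^[n] x‖})
    (fun r s hrs n hn => lt_of_le_of_lt (Nat.cast_le.2 hrs) (Set.mem_ofPred.1 hn))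
    (fun r => (hx r).2)
  refine ⟨x, D, F, hD, hF, ?_, ?_⟩
  · rw [Metric.tendsto_nhds]
    intro ε hε
    obtain ⟨r, hr⟩ := exists_nat_one_div_lt hε
    filter_upwards [hxD r] with n hn
    rw [dist_zero_right, norm_norm]
    exact lt_trans hn hr
  · rw [tendsto_atTop]
    intro b
    obtain ⟨r, hr⟩ := exists_nat_ge b
    filter_upwards [hxF r] with n hn
    exact hr.trans (le_of_lt hn)

end DistributionalChaos

/-! ### Composition operators -/

theorem apply_iterate_mul {X Y : Type*} {f : X → X} {g : X → Y} {q : ℕ}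
    (h : ∀ x, g (f^[q] x) = g x) (n : ℕ) (x : X) : g (f^[q * n] x) = g x := by
  have hs : Function.Semiconj g f^[q] id := h
  rw [Function.iterate_mul, (hs.iterate_right n).eq, Function.iterate_id, id]

section CompositionOperator

variable {X 𝕜 : Type*} [MeasurableSpace X] [RCLike 𝕜] {μ : Measure X} {p : ℝ≥0∞} [Fact (1 ≤ p)]
  {f : X → X} {T : Lp 𝕜 p μ →L[𝕜] Lp 𝕜 p μ}

theorem quasiMeasurePreserving_of_map_le (hf : Measurable f) {c : ℝ≥0∞}
    (hle : μ.map f ≤ c • μ) : Measure.QuasiMeasurePreserving f μ μ :=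
  ⟨hf, (Measure.absolutelyContinuous_of_le hle).trans Measure.smul_absolutelyContinuous⟩

theorem exists_isCompositionOperator (hf : Measurable f) {c : ℝ≥0∞} (hc : c ≠ ∞)
    (hle : μ.map f ≤ c • μ) (hp : p ≠ ∞) :
    ∃ T : Lp 𝕜 p μ →L[𝕜] Lp 𝕜 p μ, IsCompositionOperator f T := by
  have hq := quasiMeasurePreserving_of_map_le hf hle
  have hbound (φ : Lp 𝕜 p μ) :
      eLpNorm (φ ∘ f) p μ ≤ c ^ (1 / p).toReal * eLpNorm φ p μ := by
    rw [← eLpNorm_map_measure (((Lp.aestronglyMeasurable φ).mono_ac hq.2)) hf.aemeasurable]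
    refine (eLpNorm_mono_measure _ hle).trans_eq ?_
    rw [eLpNorm_smul_measure_of_ne_top hp, smul_eq_mul]
  have hck : c ^ (1 / p).toReal ≠ ∞ := ENNReal.rpow_ne_top_of_nonneg (by positivity) hc
  have hmem (φ : Lp 𝕜 p μ) : MemLp (φ ∘ f) p μ :=
    ⟨(Lp.aestronglyMeasurable φ).comp_quasiMeasurePreserving hq,
      (hbound φ).trans_lt (ENNReal.mul_lt_top hck.lt_top (Lp.eLpNorm_lt_top φ))⟩
  let L : Lp 𝕜 p μ →ₗ[𝕜] Lp 𝕜 p μ :=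
    { toFun := fun φ => (hmem φ).toLp _
      map_add' := fun φ ψ => by
        ext1
        filter_upwards [(hmem (φ + ψ)).coeFn_toLp, (hmem φ).coeFn_toLp, (hmem ψ).coeFn_toLp,
          Lp.coeFn_add ((hmem φ).toLp _) ((hmem ψ).toLp _), hq.ae (Lp.coeFn_add φ ψ)]
          with x h1 h2 h3 h4 h5
        rw [h1, h4, Pi.add_apply, h2, h3, Function.comp_apply, h5]
        rfl
      map_smul' := fun a φ => by
        ext1
        filter_upwards [(hmem (a • φ)).coeFn_toLp, (hmem φ).coeFn_toLp,
          Lp.coeFn_smul a ((hmem φ).toLp _), hq.ae (Lp.coeFn_smul a φ)] with x h1 h2 h3 h4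
        rw [h1, RingHom.id_apply, h3, Pi.smul_apply, h2, Function.comp_apply, h4]
        rfl }
  refine ⟨L.mkContinuous (c ^ (1 / p).toReal).toReal fun φ => ?_, fun φ => (hmem φ).coeFn_toLp⟩
  change ‖(hmem φ).toLp _‖ ≤ _
  rw [Lp.norm_toLp, Lp.norm_def, ← ENNReal.toReal_mul]
  exact ENNReal.toReal_mono (ENNReal.mul_ne_top hck (Lp.eLpNorm_ne_top φ)) (hbound φ)

theorem IsCompositionOperator.iterate_ae_eq (hT : IsCompositionOperator f T)
    (hq : Measure.QuasiMeasurePreserving f μ μ) (n : ℕ) (φ : Lp 𝕜 p μ) :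
    ((⇑T)^[n] φ : X → 𝕜) =ᵐ[μ] fun x => φ (f^[n] x) := by
  induction n with
  | zero => rfl
  | succ n ih =>
    rw [Function.iterate_succ_apply']
    filter_upwards [hT ((⇑T)^[n] φ), hq.ae ih] with x h1 h2
    rw [h1, Function.comp_apply, h2, Function.iterate_succ_apply]

/-- The image under `Tⁿ` of a class, computed on an arbitrary representative. -/
theorem IsCompositionOperator.iterate_ae_eq_of_ae_eq (hT : IsCompositionOperator f T)
    (hq : Measure.QuasiMeasurePreserving f μ μ) (n : ℕ) {φ : Lp 𝕜 p μ} {g : X → 𝕜}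
    (hg : (φ : X → 𝕜) =ᵐ[μ] g) : ((⇑T)^[n] φ : X → 𝕜) =ᵐ[μ] fun x => g (f^[n] x) := by
  filter_upwards [hT.iterate_ae_eq hq n φ, (hq.iterate n).ae hg] with x h1 h2
  rw [h1, h2]

theorem norm_le_mul_measureReal_rpow [IsFiniteMeasure μ] (hp : p ≠ ∞) {φ : Lp 𝕜 p μ} {s : Set X}
    (hs : MeasurableSet s) {C : ℝ} (hC : 0 ≤ C) (h0 : ∀ᵐ x ∂μ, x ∉ s → φ x = 0)
    (hb : ∀ᵐ x ∂μ, ‖φ x‖ ≤ C) : ‖φ‖ ≤ C * μ.real s ^ (1 / p.toReal) := by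
  have hp0 : p ≠ 0 := (zero_lt_one.trans_le (Fact.out : 1 ≤ p)).ne'
  rw [← abs_of_nonneg hC, ← Real.norm_eq_abs,
    ← norm_indicatorConstLp hp0 hp (hs := hs) (hμs := measure_ne_top μ s)]
  refine Lp.norm_le_norm_of_ae_le ?_
  filter_upwards [h0, hb, indicatorConstLp_coeFn (p := p) (hs := hs) (hμs := measure_ne_top μ s)
    (c := C)] with x h1 h2 h3
  rw [h3]
  by_cases hx : x ∈ s
  · simpa [hx, abs_of_nonneg hC] using h2
  · simp [hx, h1 hx]

theorem mul_measureReal_rpow_le_norm [IsFiniteMeasure μ] (hp : p ≠ ∞) {φ : Lp 𝕜 p μ} {s : Set X}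
    (hs : MeasurableSet s) {C : ℝ} (hC : 0 ≤ C) (hb : ∀ᵐ x ∂μ, x ∈ s → C ≤ ‖φ x‖) :
    C * μ.real s ^ (1 / p.toReal) ≤ ‖φ‖ := by
  have hp0 : p ≠ 0 := (zero_lt_one.trans_le (Fact.out : 1 ≤ p)).ne'
  rw [← abs_of_nonneg hC, ← Real.norm_eq_abs,
    ← norm_indicatorConstLp hp0 hp (hs := hs) (hμs := measure_ne_top μ s)]
  refine Lp.norm_le_norm_of_ae_le ?_
  filter_upwards [hb, indicatorConstLp_coeFn (p := p) (hs := hs) (hμs := measure_ne_top μ s)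
    (c := C)] with x h2 h3
  rw [h3]
  by_cases hx : x ∈ s
  · simpa [hx, abs_of_nonneg hC] using h2 hx
  · simp [hx]

/-- The classes of the bounded measurable functions `g` with `g ∘ f^q = g` everywhere, for some
`q ≥ 1`. -/
def boundedPeriodic (𝕜 : Type*) [RCLike 𝕜] (p : ℝ≥0∞) (μ : Measure X) (f : X → X) :
    Submodule 𝕜 (Lp 𝕜 p μ) where
  carrier := {φ | ∃ g : X → 𝕜, Measurable g ∧ (∃ C : ℝ, ∀ x, ‖g x‖ ≤ C) ∧
    (∃ q, 0 < q ∧ ∀ x, g (f^[q] x) = g x) ∧ (φ : X → 𝕜) =ᵐ[μ] g}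
  add_mem' := by
    rintro φ ψ ⟨g, hg, ⟨C, hC⟩, ⟨q, hq0, hq⟩, hφ⟩ ⟨h, hh, ⟨D, hD⟩, ⟨r, hr0, hr⟩, hψ⟩
    refine ⟨g + h, hg.add hh, ⟨C + D, fun x => (norm_add_le _ _).trans (add_le_add (hC x) (hD x))⟩,
      ⟨q * r, Nat.mul_pos hq0 hr0, fun x => ?_⟩, (Lp.coeFn_add φ ψ).trans (hφ.add hψ)⟩
    rw [Pi.add_apply, Pi.add_apply, apply_iterate_mul hq, mul_comm, apply_iterate_mul hr]
  zero_mem' := ⟨0, measurable_const, ⟨0, by simp⟩, ⟨1, one_pos, fun _ => rfl⟩, Lp.coeFn_zero _ _ _⟩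
  smul_mem' := by
    rintro a φ ⟨g, hg, ⟨C, hC⟩, ⟨q, hq0, hq⟩, hφ⟩
    refine ⟨a • g, hg.const_smul a, ⟨‖a‖ * C, fun x => ?_⟩, ⟨q, hq0, fun x => ?_⟩,
      (Lp.coeFn_smul a φ).trans (hφ.const_smul a)⟩
    · rw [Pi.smul_apply, norm_smul]
      exact mul_le_mul_of_nonneg_left (hC x) (norm_nonneg a)
    · rw [Pi.smul_apply, Pi.smul_apply, hq]

theorem dense_boundedPeriodic [IsFiniteMeasure μ] (hp : p ≠ ∞)
    (h : μ.MeasureDense {s | MeasurableSet s ∧ ∃ q, 0 < q ∧ f^[q] ⁻¹' s = s}) :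
    Dense (boundedPeriodic 𝕜 p μ f : Set (Lp 𝕜 p μ)) := by
  have : Fact (p ≠ ∞) := ⟨hp⟩
  refine fun φ => Lp.induction hp (fun φ => φ ∈ (boundedPeriodic 𝕜 p μ f).topologicalClosure)
    (fun c s hs hμs => ?_) (fun _ _ _ _ _ => Submodule.add_mem _)
    (Submodule.isClosed_topologicalClosure _) φ
  rw [Lp.simpleFunc.coe_indicatorConst]
  refine closure_mono ?_ (h.indicatorConstLp_subset_closure (p := p) c ⟨s, hs, hμs.ne, rfl⟩)
  rintro _ ⟨t, ⟨ht, q, hq0, hq⟩, hμt, rfl⟩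
  refine ⟨t.indicator fun _ => c, measurable_const.indicator ht, ⟨‖c‖, fun x => ?_⟩,
    ⟨q, hq0, fun x => ?_⟩, indicatorConstLp_coeFn⟩
  · exact norm_indicator_le_norm_self (fun _ => c) x
  · have hx : f^[q] x ∈ t ↔ x ∈ t := by rw [← Set.mem_preimage, hq]
    by_cases hxt : x ∈ t <;> simp [hx, hxt]

theorem isPeriodicPt_of_mem_boundedPeriodic (hT : IsCompositionOperator f T)
    (hq : Measure.QuasiMeasurePreserving f μ μ) {φ : Lp 𝕜 p μ}
    (hφ : φ ∈ boundedPeriodic 𝕜 p μ f) : φ ∈ Function.periodicPts ⇑T := by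
  obtain ⟨g, -, -, ⟨q, hq0, hgq⟩, hφg⟩ := hφ
  refine ⟨q, hq0, Lp.ext ?_⟩
  filter_upwards [hT.iterate_ae_eq_of_ae_eq hq q hφg, hφg] with x h1 h2
  rw [h1, h2, hgq]

theorem exists_pos_forall_mul_rpow_lt (hp : p ≠ ∞) (C : ℝ) {δ : ℝ} (hδ : 0 < δ) :
    ∃ ε > 0, ∀ t : ℝ, 0 ≤ t → t ≤ ε → C * t ^ (1 / p.toReal) < δ := by
  have hp0 : 0 < 1 / p.toReal := one_div_pos.2 (ENNReal.toReal_pos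
    (zero_lt_one.trans_le (Fact.out : 1 ≤ p)).ne' hp)
  have hlim : Tendsto (fun t : ℝ => C * t ^ (1 / p.toReal)) (𝓝 0) (𝓝 0) := by
    have := ((Real.continuousAt_rpow_const 0 _ (Or.inr hp0.le)).tendsto).const_mul C
    rwa [Real.zero_rpow hp0.ne', mul_zero] at this
  obtain ⟨ε, hε, h⟩ := Metric.eventually_nhds_iff.1 (hlim.eventually (gt_mem_nhds hδ))
  refine ⟨ε / 2, half_pos hε, fun t ht0 ht => h ?_⟩
  rw [Real.dist_eq, sub_zero, abs_of_nonneg ht0]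
  linarith

/-- If `μ` and its images under `fⁿ` become mutually singular in the limit, the sets `B n` being
asymptotic witnesses, then the composition operator is mixing. To go from near `g` to near the
`q`-periodic `h`, take the function equal to `g` on `B n` and to `h ∘ f^j` off `B n`, where
`q ∣ j + n`. -/
theorem IsCompositionOperator.isMixing [IsFiniteMeasure μ] (hp : p ≠ ∞)
    (hT : IsCompositionOperator f T) (hq : Measure.QuasiMeasurePreserving f μ μ)
    (hd : Dense (boundedPeriodic 𝕜 p μ f : Set (Lp 𝕜 p μ))) {B : ℕ → Set X}
    (hB : ∀ n, MeasurableSet (B n)) (h1 : Tendsto (fun n => μ.real (B n)ᶜ) atTop (𝓝 0))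
    (h2 : Tendsto (fun n => μ.real (f^[n] ⁻¹' B n)) atTop (𝓝 0)) : IsMixing T := by
  intro U V hU hV hUne hVne
  obtain ⟨φ, hφU, g, hg, ⟨C, hC⟩, -, hφ⟩ := hd.inter_open_nonempty U hU hUne
  obtain ⟨ψ, hψV, h, hh, ⟨D, hD⟩, ⟨q, hq0, hhq⟩, hψ⟩ := hd.inter_open_nonempty V hV hVne
  obtain ⟨ε₁, hε₁, hU'⟩ := Metric.isOpen_iff.1 hU φ hφU
  obtain ⟨ε₂, hε₂, hV'⟩ := Metric.isOpen_iff.1 hV ψ hψV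
  obtain ⟨δ₁, hδ₁, hδ₁'⟩ := exists_pos_forall_mul_rpow_lt hp (|D| + |C|) hε₁
  obtain ⟨δ₂, hδ₂, hδ₂'⟩ := exists_pos_forall_mul_rpow_lt hp (|C| + |D|) hε₂
  have hC' (x : X) : ‖g x‖ ≤ |C| := (hC x).trans (le_abs_self C)
  have hD' (x : X) : ‖h x‖ ≤ |D| := (hD x).trans (le_abs_self D)
  obtain ⟨n₀, hn₀⟩ := eventually_atTop.1
    ((h1.eventually (gt_mem_nhds hδ₁)).and (h2.eventually (gt_mem_nhds hδ₂)))
  refine ⟨n₀, fun n hn => ?_⟩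
  obtain ⟨hn1, hn2⟩ := hn₀ n hn
  obtain ⟨j, hj⟩ : ∃ j, j + n = q * n := ⟨q * n - n, Nat.sub_add_cancel
    (Nat.le_mul_of_pos_left n hq0)⟩
  classical
  let w : X → 𝕜 := (B n).piecewise g fun x => h (f^[j] x)
  have hw : Measurable w := hg.piecewise (hB n) (hh.comp (hq.measurable.iterate j))
  have hwb (x : X) : ‖w x‖ ≤ |C| + |D| := by
    by_cases hx : x ∈ B n
    · simp only [w, Set.piecewise_eq_of_mem _ _ _ hx]
      linarith [hC' x, abs_nonneg D]
    · simp only [w, Set.piecewise_eq_of_notMem _ _ _ hx]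
      linarith [hD' (f^[j] x), abs_nonneg C]
  have hwm : MemLp w p μ := MemLp.of_bound hw.aestronglyMeasurable _ (Eventually.of_forall hwb)
  refine ⟨(⇑T)^[n] (hwm.toLp w), ⟨hwm.toLp w, hU' ?_, rfl⟩, hV' ?_⟩
  · rw [mem_ball_iff_norm]
    refine (norm_le_mul_measureReal_rpow hp (hB n).compl (by positivity) ?_ ?_).trans_lt
      (hδ₁' _ measureReal_nonneg hn1.le)
    · filter_upwards [Lp.coeFn_sub (hwm.toLp w) φ, hwm.coeFn_toLp, hφ] with x e1 e2 e3 hx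
      rw [e1, Pi.sub_apply, e2, e3]
      simp only [w, Set.piecewise_eq_of_mem _ _ _ (Set.notMem_compl_iff.1 hx), sub_self]
    · filter_upwards [Lp.coeFn_sub (hwm.toLp w) φ, hwm.coeFn_toLp, hφ] with x e1 e2 e3
      rw [e1, Pi.sub_apply, e2, e3]
      by_cases hx : x ∈ B n
      · simp only [w, Set.piecewise_eq_of_mem _ _ _ hx, sub_self, norm_zero]
        positivity
      · simp only [w, Set.piecewise_eq_of_notMem _ _ _ hx]
        exact (norm_sub_le _ _).trans (add_le_add (hD' _) (hC' _))
  · rw [mem_ball_iff_norm]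
    have hTw := hT.iterate_ae_eq_of_ae_eq hq n hwm.coeFn_toLp
    have hback (x : X) : h (f^[j] (f^[n] x)) = h x := by
      rw [← Function.iterate_add_apply, hj, apply_iterate_mul hhq]
    refine (norm_le_mul_measureReal_rpow hp ((hq.measurable.iterate n) (hB n))
      (by positivity) ?_ ?_).trans_lt (hδ₂' _ measureReal_nonneg hn2.le)
    · filter_upwards [Lp.coeFn_sub ((⇑T)^[n] (hwm.toLp w)) ψ, hTw, hψ] with x e1 e2 e3 hx
      rw [e1, Pi.sub_apply, e2, e3]
      simp only [w, Set.piecewise_eq_of_notMem _ _ _ (show f^[n] x ∉ B n from hx), hback, sub_self]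
    · filter_upwards [Lp.coeFn_sub ((⇑T)^[n] (hwm.toLp w)) ψ, hTw, hψ] with x e1 e2 e3
      rw [e1, Pi.sub_apply, e2, e3]
      by_cases hx : f^[n] x ∈ B n
      · simp only [w, Set.piecewise_eq_of_mem _ _ _ hx]
        exact (norm_sub_le _ _).trans (add_le_add (hC' _) (hD' _))
      · simp only [w, Set.piecewise_eq_of_notMem _ _ _ hx, hback, sub_self, norm_zero]
        positivity

/-- Distributional chaos from asymptotic singularity of `μ` and its images under `fⁿ` for most `n`
in arbitrarily long time intervals. Restricting a bounded function to `B` makes its orbit small at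
those times; adding a large multiple of the indicator of `Bᶜ`, a small set with almost full
preimages, makes it large. -/
theorem IsCompositionOperator.isDistributionallyChaotic [IsProbabilityMeasure μ] (hp : p ≠ ∞)
    (hT : IsCompositionOperator f T) (hq : Measure.QuasiMeasurePreserving f μ μ)
    (hd : Dense (boundedPeriodic 𝕜 p μ f : Set (Lp 𝕜 p μ)))
    (h : ∀ (r : ℕ) (ε : ℝ), 0 < ε → ∃ N : ℕ, r < N ∧ ∃ B : Set X, MeasurableSet B ∧
      μ.real Bᶜ ≤ ε ∧ (1 - 1 / ((r : ℝ) + 1)) * N ≤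
        ((Set.Icc 1 N ∩ {n | μ.real (f^[n] ⁻¹' B) ≤ ε}).ncard : ℝ)) :
    IsDistributionallyChaotic T := by
  have hp1 : 1 / p.toReal ≤ 1 := by
    have : 1 ≤ p.toReal := (ENNReal.dichotomy p).resolve_left hp
    exact div_le_one_of_le₀ this (by positivity)
  have hmono {N : ℕ} {a : ℝ} {s t : Set ℕ} (hst : s ⊆ t)
      (ha : a ≤ ((Set.Icc 1 N ∩ s).ncard : ℝ)) : a ≤ ((Set.Icc 1 N ∩ t).ncard : ℝ) :=
    ha.trans (Nat.cast_le.2 (Set.ncard_le_ncard (Set.inter_subset_inter_right _ hst)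
      ((Set.finite_Icc _ _).inter_of_left _)))
  refine IsDistributionallyChaotic.of_dense (fun r => ?_) (fun r => ?_)
  · refine dense_iff_inter_open.2 fun U hU hUne => ?_
    obtain ⟨φ, hφU, g, hg, ⟨C, hC⟩, -, hφ⟩ := hd.inter_open_nonempty U hU hUne
    have hC' (x : X) : ‖g x‖ ≤ |C| := (hC x).trans (le_abs_self C)
    obtain ⟨ε₁, hε₁, hU'⟩ := Metric.isOpen_iff.1 hU φ hφU
    obtain ⟨ε, hε, hε'⟩ := exists_pos_forall_mul_rpow_lt hp |C|
      (lt_min hε₁ (Nat.one_div_pos_of_nat (α := ℝ) (n := r)))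
    obtain ⟨N, hN, B, hB, hBc, hBN⟩ := h r ε hε
    have hw : Measurable (B.indicator g) := hg.indicator hB
    have hwb (x : X) : ‖B.indicator g x‖ ≤ |C| :=
      (norm_indicator_le_norm_self g x).trans (hC' x)
    have hwm : MemLp (B.indicator g) p μ :=
      MemLp.of_bound hw.aestronglyMeasurable _ (Eventually.of_forall hwb)
    refine ⟨hwm.toLp _, hU' ?_, N, hN, hmono (fun n hn => ?_) hBN⟩
    · rw [mem_ball_iff_norm]
      refine (norm_le_mul_measureReal_rpow hp hB.compl (abs_nonneg C) ?_ ?_).trans_lt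
        ((hε' _ measureReal_nonneg hBc).trans_le (min_le_left _ _))
      · filter_upwards [Lp.coeFn_sub (hwm.toLp _) φ, hwm.coeFn_toLp, hφ] with x e1 e2 e3 hx
        rw [e1, Pi.sub_apply, e2, e3, Set.indicator_of_mem (Set.notMem_compl_iff.1 hx), sub_self]
      · filter_upwards [Lp.coeFn_sub (hwm.toLp _) φ, hwm.coeFn_toLp, hφ] with x e1 e2 e3
        rw [e1, Pi.sub_apply, e2, e3]
        by_cases hx : x ∈ B
        · rw [Set.indicator_of_mem hx, sub_self, norm_zero]
          positivity
        · rw [Set.indicator_of_notMem hx, zero_sub, norm_neg]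
          exact hC' x
    · refine (norm_le_mul_measureReal_rpow hp ((hq.measurable.iterate n) hB) (abs_nonneg C)
        ?_ ?_).trans_lt ((hε' _ measureReal_nonneg hn).trans_le (min_le_right _ _))
      · filter_upwards [hT.iterate_ae_eq_of_ae_eq hq n hwm.coeFn_toLp] with x e1 hx
        rw [e1, Set.indicator_of_notMem (show f^[n] x ∉ B from hx)]
      · filter_upwards [hT.iterate_ae_eq_of_ae_eq hq n hwm.coeFn_toLp] with x e1
        rw [e1]
        exact hwb _
  · refine dense_iff_inter_open.2 fun U hU hUne => ?_
    obtain ⟨φ, hφU, g, hg, ⟨C, hC⟩, -, hφ⟩ := hd.inter_open_nonempty U hU hUne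
    have hC' (x : X) : ‖g x‖ ≤ |C| := (hC x).trans (le_abs_self C)
    obtain ⟨ε₁, hε₁, hU'⟩ := Metric.isOpen_iff.1 hU φ hφU
    -- the orbit of `φ` is bounded by `|C|`, and the added vector has norm at least `a / 2` at the
    -- times in question
    let a : ℝ := 2 * (|C| + r + 1)
    have ha : 0 ≤ a := by positivity
    obtain ⟨ε, hε, hε'⟩ := exists_pos_forall_mul_rpow_lt hp a hε₁
    obtain ⟨N, hN, B, hB, hBc, hBN⟩ := h r (min ε (1 / 2)) (by positivity)
    let ψ : Lp 𝕜 p μ := indicatorConstLp p hB.compl (measure_ne_top μ _) (a : 𝕜)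
    have hψ : (ψ : X → 𝕜) =ᵐ[μ] Bᶜ.indicator fun _ => (a : 𝕜) := indicatorConstLp_coeFn
    have hna : ‖(a : 𝕜)‖ = a := by rw [RCLike.norm_ofReal, abs_of_nonneg ha]
    refine ⟨φ + ψ, hU' ?_, N, hN, hmono (fun n hn => ?_) hBN⟩
    · rw [mem_ball_iff_norm, add_sub_cancel_left]
      refine (norm_le_mul_measureReal_rpow hp hB.compl ha ?_ ?_).trans_lt
        (hε' _ measureReal_nonneg (hBc.trans (min_le_left _ _)))
      · filter_upwards [hψ] with x e1 hx
        rw [e1, Set.indicator_of_notMem hx]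
      · filter_upwards [hψ] with x e1
        rw [e1]
        exact (norm_indicator_le_norm_self _ x).trans_eq hna
    · have hsum : (⇑T)^[n] (φ + ψ) = (⇑T)^[n] φ + (⇑T)^[n] ψ := iterate_map_add T n φ ψ
      have hφn : ‖(⇑T)^[n] φ‖ ≤ |C| := by
        have := norm_le_mul_measureReal_rpow hp (φ := (⇑T)^[n] φ) MeasurableSet.univ
          (abs_nonneg C) (by simp) (by
            filter_upwards [hT.iterate_ae_eq_of_ae_eq hq n hφ] with x e1
            rw [e1]
            exact hC' _)
        simpa using this
      have hm : 1 / 2 ≤ μ.real (f^[n] ⁻¹' Bᶜ) := by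
        have h1 : μ.real (f^[n] ⁻¹' B) ≤ 1 / 2 := hn.trans (min_le_right _ _)
        rw [Set.preimage_compl, probReal_compl_eq_one_sub ((hq.measurable.iterate n) hB)]
        linarith
      have hψn : a / 2 ≤ ‖(⇑T)^[n] ψ‖ := by
        have h1 := mul_measureReal_rpow_le_norm hp (φ := (⇑T)^[n] ψ)
          ((hq.measurable.iterate n) hB.compl) ha (by
            filter_upwards [hT.iterate_ae_eq_of_ae_eq hq n hψ] with x e1 hx
            rw [e1, Set.indicator_of_mem (show f^[n] x ∈ Bᶜ from hx), hna])
        have h2 : μ.real (f^[n] ⁻¹' Bᶜ) ≤ μ.real (f^[n] ⁻¹' Bᶜ) ^ (1 / p.toReal) :=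
          Real.self_le_rpow_of_le_one measureReal_nonneg measureReal_le_one hp1
        have h3 := mul_le_mul_of_nonneg_left (hm.trans h2) ha
        linarith
      have h4 : ‖(⇑T)^[n] ψ‖ ≤ ‖(⇑T)^[n] φ + (⇑T)^[n] ψ‖ + ‖(⇑T)^[n] φ‖ := by
        simpa using norm_sub_le ((⇑T)^[n] φ + (⇑T)^[n] ψ) ((⇑T)^[n] φ)
      change (r : ℝ) < ‖(⇑T)^[n] (φ + ψ)‖
      rw [hsum]
      simp only [a] at hψn
      linarith

end CompositionOperator

/-! ### Cotype of `L^p` -/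

section Cotype

variable {X 𝕜 : Type*} [MeasurableSpace X] [RCLike 𝕜] {μ : Measure X} {p : ℝ≥0∞} [Fact (1 ≤ p)]

theorem two_mul_norm_rpow_add_norm_rpow_le {r : ℝ} (hr : 2 ≤ r) (a b : 𝕜) :
    2 * (‖a‖ ^ r + ‖b‖ ^ r) ≤ ‖a + b‖ ^ r + ‖a - b‖ ^ r := by
  have hr1 : 1 ≤ r / 2 := by linarith
  have hsq (x : 𝕜) : ‖x‖ ^ r = (‖x‖ ^ 2) ^ (r / 2) := by
    rw [← Real.rpow_natCast, ← Real.rpow_mul (norm_nonneg x)]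
    congr 1
    push_cast
    ring
  have hpar := parallelogram_law_with_norm 𝕜 a b
  have hconv := (convexOn_rpow hr1).2 (Set.mem_Ici.2 (sq_nonneg ‖a + b‖))
    (Set.mem_Ici.2 (sq_nonneg ‖a - b‖)) (by norm_num : (0 : ℝ) ≤ 1 / 2)
    (by norm_num : (0 : ℝ) ≤ 1 / 2) (by norm_num)
  simp only [smul_eq_mul] at hconv
  have hmid : 1 / 2 * ‖a + b‖ ^ 2 + 1 / 2 * ‖a - b‖ ^ 2 = ‖a‖ ^ 2 + ‖b‖ ^ 2 := by
    nlinarith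
  rw [hmid] at hconv
  have hadd := Real.add_rpow_le_rpow_add (sq_nonneg ‖a‖) (sq_nonneg ‖b‖) hr1
  rw [hsq a, hsq b, hsq (a + b), hsq (a - b)]
  linarith

theorem Lp.norm_rpow_eq_integral (hp : p ≠ ∞) (φ : Lp 𝕜 p μ) :
    ‖φ‖ ^ p.toReal = ∫ x, ‖φ x‖ ^ p.toReal ∂μ := by
  have hp0 : p ≠ 0 := (zero_lt_one.trans_le (Fact.out : 1 ≤ p)).ne'
  have hp' : 0 < p.toReal := ENNReal.toReal_pos hp0 hp
  rw [Lp.norm_def, MemLp.eLpNorm_eq_integral_rpow_norm hp0 hp (Lp.memLp φ)]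
  have h0 : 0 ≤ ∫ x, ‖φ x‖ ^ p.toReal ∂μ := integral_nonneg fun x => by positivity
  rw [ENNReal.toReal_ofReal (by positivity), Real.rpow_inv_rpow h0 hp'.ne']

/-- The easy half of Clarkson's inequalities. -/
theorem Lp.two_mul_norm_rpow_add_norm_rpow_le (hp2 : 2 ≤ p) (hp : p ≠ ∞) (φ ψ : Lp 𝕜 p μ) :
    2 * (‖φ‖ ^ p.toReal + ‖ψ‖ ^ p.toReal) ≤ ‖φ + ψ‖ ^ p.toReal + ‖φ - ψ‖ ^ p.toReal := by
  have hp0 : p ≠ 0 := (zero_lt_one.trans_le (Fact.out : 1 ≤ p)).ne'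
  have hr : 2 ≤ p.toReal := by simpa using ENNReal.toReal_mono hp hp2
  have hi (χ : Lp 𝕜 p μ) : Integrable (fun x => ‖χ x‖ ^ p.toReal) μ :=
    (Lp.memLp χ).integrable_norm_rpow hp0 hp
  simp only [Lp.norm_rpow_eq_integral hp]
  rw [← integral_add (hi φ) (hi ψ), ← integral_const_mul, ← integral_add (hi _) (hi _)]
  refine integral_mono_ae (((hi φ).add (hi ψ)).const_mul 2) ((hi _).add (hi _)) ?_
  filter_upwards [Lp.coeFn_add φ ψ, Lp.coeFn_sub φ ψ] with x h1 h2
  simp only [h1, h2, Pi.add_apply, Pi.sub_apply]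
  exact LinearDynamics.two_mul_norm_rpow_add_norm_rpow_le hr _ _

/-- Averaging Clarkson's inequality over all choices of signs. -/
theorem Lp.norm_rpow_add_sum_norm_rpow_le {ι : Type*} (hp2 : 2 ≤ p) (hp : p ≠ ∞)
    (F : ι → Lp 𝕜 p μ) {K : ℝ} (s : Finset ι) (y : Lp 𝕜 p μ)
    (h : ∀ t : Set ι, ∀ [DecidablePred (· ∈ t)],
      ‖y + ∑ i ∈ s, (if i ∈ t then F i else -F i)‖ ≤ K) :
    ‖y‖ ^ p.toReal + ∑ i ∈ s, ‖F i‖ ^ p.toReal ≤ K ^ p.toReal := by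
  classical
  induction s using Finset.induction_on generalizing y with
  | empty =>
    have := h ∅
    simp only [Finset.sum_empty, add_zero] at this ⊢
    exact Real.rpow_le_rpow (norm_nonneg y) this ENNReal.toReal_nonneg
  | insert a s ha ih =>
    have h1 := ih (y + F a) fun t _ => by
      have := h (insert a t)
      rw [Finset.sum_insert ha, if_pos (Set.mem_insert a t), ← add_assoc] at this
      convert this using 3
      refine Finset.sum_congr rfl fun i hi => ?_
      have hia : i ≠ a := fun e => ha (e ▸ hi)
      simp [hia]
    have h2 := ih (y - F a) fun t _ => by
      have := h (t \ {a})
      rw [Finset.sum_insert ha, if_neg (by simp), ← add_assoc, ← sub_eq_add_neg] at this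
      convert this using 3
      refine Finset.sum_congr rfl fun i hi => ?_
      have hia : i ≠ a := fun e => ha (e ▸ hi)
      simp [hia]
    have h3 := Lp.two_mul_norm_rpow_add_norm_rpow_le hp2 hp y (F a)
    rw [Finset.sum_insert ha]
    linarith

/-- For `2 ≤ p < ∞`, the space `L^p` has cotype `p`; this is the consequence for unconditionally
convergent series. -/
theorem Lp.summable_norm_rpow {ι : Type*} (hp2 : 2 ≤ p) (hp : p ≠ ∞) {F : ι → Lp 𝕜 p μ}
    (hF : Summable F) : Summable fun i => ‖F i‖ ^ p.toReal := by
  classical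
  obtain ⟨s₀, hs₀⟩ := summable_iff_vanishing_norm.1 hF 1 one_pos
  have hbd (t : Finset ι) : ‖∑ i ∈ t, F i‖ ≤ (∑ i ∈ s₀, ‖F i‖) + 1 := by
    rw [← Finset.sum_inter_add_sum_sdiff t s₀]
    refine (norm_add_le _ _).trans (add_le_add ((norm_sum_le _ _).trans ?_) ?_)
    · exact Finset.sum_le_sum_of_subset_of_nonneg Finset.inter_subset_right
        fun _ _ _ => norm_nonneg _
    · exact (hs₀ _ Finset.sdiff_disjoint).le
  refine summable_of_sum_le (c := (2 * ((∑ i ∈ s₀, ‖F i‖) + 1)) ^ p.toReal)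
    (fun i => by positivity) fun s => ?_
  have := Lp.norm_rpow_add_sum_norm_rpow_le hp2 hp F (K := 2 * ((∑ i ∈ s₀, ‖F i‖) + 1)) s 0
    fun t _ => by
      rw [zero_add, Finset.sum_ite, Finset.sum_neg_distrib, ← sub_eq_add_neg, two_mul]
      exact (norm_sub_le _ _).trans (add_le_add (hbd _) (hbd _))
  have h0 : (0 : ℝ) ≤ ‖(0 : Lp 𝕜 p μ)‖ ^ p.toReal := by positivity
  linarith

end Cotype

/-! ### Summable orbits and conservativity -/

section FrequentHypercyclicityCriterion

variable {X 𝕜 : Type*} [MeasurableSpace X] [RCLike 𝕜] {μ : Measure X} {p : ℝ≥0∞} [Fact (1 ≤ p)]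
  {f : X → X} {T : Lp 𝕜 p μ →L[𝕜] Lp 𝕜 p μ}

/-- For conservative `f` and `2 ≤ p < ∞`, no nonzero orbit is unconditionally summable: otherwise
`∑ μ (f⁻ⁿ {δ ≤ |φ|})` would be finite, and by Borel–Cantelli almost no point would return to
`{δ ≤ |φ|}` infinitely often. -/
theorem IsCompositionOperator.eq_zero_of_summable [IsFiniteMeasure μ] (hp2 : 2 ≤ p) (hp : p ≠ ∞)
    (hT : IsCompositionOperator f T) (hf : Conservative f μ) {φ : Lp 𝕜 p μ}
    (hφ : Summable fun n : ℕ => (⇑T)^[n] φ) : φ = 0 := by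
  have hp0 : p ≠ 0 := (zero_lt_one.trans_le (Fact.out : 1 ≤ p)).ne'
  have hp' : 0 < p.toReal := ENNReal.toReal_pos hp0 hp
  have hsum := Lp.summable_norm_rpow hp2 hp hφ
  have hlevel (k : ℕ) : μ {x | 1 / ((k : ℝ) + 1) ≤ ‖φ x‖} = 0 := by
    set δ : ℝ := 1 / ((k : ℝ) + 1) with hδ
    have hδ0 : 0 < δ := Nat.one_div_pos_of_nat
    set A := {x | δ ≤ ‖φ x‖} with hA
    have hAm : MeasurableSet A :=
      measurableSet_le measurable_const (Lp.stronglyMeasurable φ).norm.measurable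
    have hle (n : ℕ) : μ.real (f^[n] ⁻¹' A) ≤ (δ ^ p.toReal)⁻¹ * ‖(⇑T)^[n] φ‖ ^ p.toReal := by
      have h1 := mul_measureReal_rpow_le_norm hp (φ := (⇑T)^[n] φ)
        ((hf.measurable.iterate n) hAm) hδ0.le (by
          filter_upwards [hT.iterate_ae_eq hf.toQuasiMeasurePreserving n φ] with x e1 hx
          rw [e1]
          exact hx)
      have h2 := Real.rpow_le_rpow (by positivity) h1 hp'.le
      rw [Real.mul_rpow hδ0.le (by positivity), ← Real.rpow_mul measureReal_nonneg,
        one_div_mul_cancel hp'.ne', Real.rpow_one] at h2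
      rw [inv_mul_eq_div, le_div_iff₀ (by positivity), mul_comm]
      exact h2
    have hs : Summable fun n => μ.real (f^[n] ⁻¹' A) :=
      Summable.of_nonneg_of_le (fun _ => measureReal_nonneg) hle (hsum.mul_left _)
    have htsum : ∑' n, μ (f^[n] ⁻¹' A) ≠ ∞ := by
      simpa [measureReal_def, ENNReal.ofReal_toReal, measure_ne_top] using hs.tsum_ofReal_ne_top
    have hfin : ∀ᵐ x ∂μ, ¬∃ᶠ n in atTop, f^[n] x ∈ A := by
      simpa using ae_eventually_notMem htsum
    rw [measure_eq_zero_iff_ae_notMem]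
    filter_upwards [hfin, hf.ae_mem_imp_frequently_image_mem hAm.nullMeasurableSet]
      with x h1 h2 hx using h1 (h2 hx)
  refine Lp.ext ?_
  filter_upwards [ae_all_iff.2 fun k => measure_eq_zero_iff_ae_notMem.1 (hlevel k),
    Lp.coeFn_zero 𝕜 p μ] with x h1 h2
  rw [h2, Pi.zero_apply]
  by_contra hx
  obtain ⟨k, hk⟩ := exists_nat_one_div_lt (norm_pos_iff.2 hx)
  exact h1 k hk.le

theorem IsCompositionOperator.not_satisfiesFHC [IsFiniteMeasure μ] [NeZero μ] (hp2 : 2 ≤ p)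
    (hp : p ≠ ∞) (hT : IsCompositionOperator f T) (hf : Conservative f μ) :
    ¬SatisfiesFHC T := by
  rintro ⟨X₀, hX₀, S, hS⟩
  have hp0 : p ≠ 0 := (zero_lt_one.trans_le (Fact.out : 1 ≤ p)).ne'
  have hone : indicatorConstLp p MeasurableSet.univ (measure_ne_top μ _) (1 : 𝕜) ≠ 0 := by
    rw [← norm_pos_iff, norm_indicatorConstLp hp0 hp, norm_one, one_mul]
    exact Real.rpow_pos_of_pos (by simp [measureReal_def, ENNReal.toReal_pos_iff,
      pos_iff_ne_zero, NeZero.ne]) _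
  obtain ⟨x, hx0, hx⟩ := hX₀.inter_open_nonempty {0}ᶜ isOpen_compl_singleton ⟨_, hone⟩
  exact hx0 (hT.eq_zero_of_summable hp2 hp hf (hS ⟨x, hx⟩).1)

end FrequentHypercyclicityCriterion

namespace OdometerSystem

variable (S : OdometerSystem)

/-! ### Mixed radix digits and the action of the odometer -/

section Digits

/-- The weight `∏ j < N, αⱼ` of the digit `N` in the mixed radix expansion attached to `S`. -/
def place (N : ℕ) : ℕ := ∏ j ∈ Finset.range N, S.α j

/-- The integer whose mixed radix digits are the first `N` coordinates of `x`. -/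
def value (N : ℕ) (x : S.Space) : ℕ := ∑ j ∈ Finset.range N, (x j : ℕ) * S.place j

theorem alpha_pos (n : ℕ) : 0 < S.α n := two_pos.trans_le (S.two_le n)

theorem place_zero : S.place 0 = 1 := rfl

theorem place_succ (N : ℕ) : S.place (N + 1) = S.place N * S.α N := Finset.prod_range_succ _ _

theorem place_pos (N : ℕ) : 0 < S.place N := Finset.prod_pos fun j _ => S.alpha_pos j

theorem two_mul_place_le (N : ℕ) : 2 * S.place N ≤ S.place (N + 1) := by
  rw [place_succ, mul_comm]
  exact Nat.mul_le_mul_left _ (S.two_le N)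

theorem two_pow_mul_place_le (N k : ℕ) : 2 ^ k * S.place N ≤ S.place (N + k) := by
  induction k with
  | zero => simp
  | succ k ih =>
    have := S.two_mul_place_le (N + k)
    rw [pow_succ, ← add_assoc]
    linarith

theorem place_strictMono : StrictMono S.place := strictMono_nat_of_lt_succ fun N => by
  have := S.two_mul_place_le N
  have := S.place_pos N
  omega

theorem value_succ (N : ℕ) (x : S.Space) :
    S.value (N + 1) x = S.value N x + (x N : ℕ) * S.place N := Finset.sum_range_succ _ _

theorem value_lt (N : ℕ) (x : S.Space) : S.value N x < S.place N := by
  induction N with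
  | zero => simp [value, place_zero]
  | succ N ih =>
    rw [value_succ, place_succ]
    have := (x N).isLt
    nlinarith

theorem eq_of_value_eq {N : ℕ} {x y : S.Space} (h : S.value N x = S.value N y) :
    ∀ j < N, x j = y j := by
  induction N with
  | zero => intro j hj; omega
  | succ N ih =>
    rw [value_succ, value_succ] at h
    have hx := S.value_lt N x
    have hy := S.value_lt N y
    have hmod := congrArg (· % S.place N) h
    have hdiv := congrArg (· / S.place N) h
    simp only [Nat.add_mul_mod_self_right, Nat.mod_eq_of_lt hx, Nat.mod_eq_of_lt hy] at hmod
    simp only [Nat.add_mul_div_right _ _ (S.place_pos N), Nat.div_eq_of_lt hx,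
      Nat.div_eq_of_lt hy, zero_add] at hdiv
    intro j hj
    rcases Nat.lt_succ_iff_lt_or_eq.1 hj with hj | rfl
    · exact ih hmod j hj
    · exact Fin.ext hdiv

theorem value_add_one_of_forall {N : ℕ} {x : S.Space} (h : ∀ j < N, (x j : ℕ) + 1 = S.α j) :
    S.value N x + 1 = S.place N := by
  induction N with
  | zero => simp [value, place_zero]
  | succ N ih =>
    have h1 := ih fun j hj => h j (hj.trans N.lt_succ_self)
    have h2 := congrArg (S.place N * ·) (h N N.lt_succ_self)
    rw [value_succ, place_succ]
    linarith

theorem value_map_of_forall {N : ℕ} {x : S.Space} (h : ∀ j < N, (x j : ℕ) + 1 = S.α j) :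
    S.value N (S.map x) = 0 := by
  refine Finset.sum_eq_zero fun j hj => ?_
  have hj' := Finset.mem_range.1 hj
  have : (S.map x j : ℕ) = 0 := by
    simp only [map]
    rw [if_pos fun i hi => h i (hi.trans hj')]
    exact (congrArg (· % S.α j) (h j hj')).trans (Nat.mod_self _)
  rw [this, zero_mul]

theorem map_apply_of_not_forall {N : ℕ} {x : S.Space} (h : ¬∀ j < N, (x j : ℕ) + 1 = S.α j)
    {n : ℕ} (hn : N ≤ n) : S.map x n = x n :=
  if_neg fun h' => h fun j hj => h' j (hj.trans_le hn)

theorem value_map_of_not_forall {N : ℕ} {x : S.Space} (h : ¬∀ j < N, (x j : ℕ) + 1 = S.α j) :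
    S.value N (S.map x) = S.value N x + 1 := by
  induction N with
  | zero => simp at h
  | succ N ih =>
    rw [value_succ, value_succ]
    by_cases hN : ∀ j < N, (x j : ℕ) + 1 = S.α j
    · have hx : (x N : ℕ) + 1 ≠ S.α N := fun e => h fun j hj =>
        (Nat.lt_succ_iff_lt_or_eq.1 hj).elim (hN j) fun e' => e' ▸ e
      have hmap : (S.map x N : ℕ) = (x N : ℕ) + 1 := by
        simp only [map]
        rw [if_pos hN]
        exact Nat.mod_eq_of_lt (lt_of_le_of_ne (x N).isLt hx)
      rw [S.value_map_of_forall hN, hmap, ← S.value_add_one_of_forall hN]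
      ring
    · rw [ih hN, S.map_apply_of_not_forall hN le_rfl]
      ring

theorem not_forall_of_value_add_one_lt {N : ℕ} {x : S.Space} (h : S.value N x + 1 < S.place N) :
    ¬∀ j < N, (x j : ℕ) + 1 = S.α j := fun h' => h.ne (S.value_add_one_of_forall h')

/-- On the first `N` coordinates, the odometer is the addition of one modulo `place N`. -/
theorem value_map_mod (N : ℕ) (x : S.Space) :
    S.value N (S.map x) % S.place N = (S.value N x + 1) % S.place N := by
  by_cases h : ∀ j < N, (x j : ℕ) + 1 = S.α j
  · rw [S.value_map_of_forall h, S.value_add_one_of_forall h, Nat.mod_self, Nat.zero_mod]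
  · rw [S.value_map_of_not_forall h]

theorem value_iterate_map_mod (N n : ℕ) (x : S.Space) :
    S.value N (S.map^[n] x) % S.place N = (S.value N x + n) % S.place N := by
  induction n with
  | zero => rfl
  | succ n ih =>
    rw [Function.iterate_succ_apply', value_map_mod, Nat.add_mod, ih, ← Nat.add_mod, add_assoc]

/-- As long as there is no carry past the first `N` coordinates, iterating the odometer adds to
the value of these coordinates and leaves the others alone. -/
theorem value_iterate_map {N n : ℕ} {x : S.Space} (h : S.value N x + n < S.place N) :
    S.value N (S.map^[n] x) = S.value N x + n ∧ ∀ j, N ≤ j → S.map^[n] x j = x j := by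
  induction n with
  | zero => exact ⟨rfl, fun _ _ => rfl⟩
  | succ n ih =>
    obtain ⟨h1, h2⟩ := ih (by omega)
    have h3 := S.not_forall_of_value_add_one_lt (N := N) (x := S.map^[n] x) (by omega)
    rw [Function.iterate_succ_apply', S.value_map_of_not_forall h3, h1, add_assoc]
    exact ⟨rfl, fun j hj => (S.map_apply_of_not_forall h3 hj).trans (h2 j hj)⟩

theorem iterate_map_place_apply {N j : ℕ} (hj : j < N) (x : S.Space) :
    S.map^[S.place N] x j = x j := by
  refine S.eq_of_value_eq ?_ j hj
  have := S.value_iterate_map_mod N (S.place N) x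
  rwa [Nat.add_mod_right, Nat.mod_eq_of_lt (S.value_lt _ _),
    Nat.mod_eq_of_lt (S.value_lt _ _)] at this

/-- Replace the first `N` coordinates by the digits of `v`. -/
def setPrefix (N v : ℕ) (x : S.Space) : S.Space := fun j =>
  if j < N then ⟨v / S.place j % S.α j, Nat.mod_lt _ (S.alpha_pos j)⟩ else x j

theorem setPrefix_apply_of_le {N j : ℕ} (hj : N ≤ j) (v : ℕ) (x : S.Space) :
    S.setPrefix N v x j = x j := if_neg hj.not_gt

theorem value_setPrefix {N v : ℕ} (hv : v < S.place N) (x : S.Space) :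
    S.value N (S.setPrefix N v x) = v := by
  have h (M : ℕ) (hM : M ≤ N) : S.value M (S.setPrefix N v x) = v % S.place M := by
    induction M with
    | zero => simp [value, place_zero, Nat.mod_one]
    | succ M ih =>
      rw [value_succ, ih (by omega), place_succ, Nat.mod_mul, setPrefix,
        if_pos (Nat.lt_of_succ_le hM)]
      ring
  rw [h N le_rfl, Nat.mod_eq_of_lt hv]

theorem setPrefix_eq {N v : ℕ} (hv : v < S.place N) {x y : S.Space} (hy : S.value N y = v)
    (hxy : ∀ j, N ≤ j → y j = x j) : S.setPrefix N v x = y := by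
  funext j
  rcases lt_or_ge j N with hj | hj
  · exact S.eq_of_value_eq ((S.value_setPrefix hv x).trans hy.symm) j hj
  · rw [S.setPrefix_apply_of_le hj, hxy j hj]

end Digits

/-! ### The product measure -/

section Measure

open ProbabilityTheory

instance : IsProbabilityMeasure S.measure := by unfold measure; infer_instance

theorem measurable_value (N : ℕ) : Measurable (S.value N) :=
  Finset.measurable_sum _ fun j _ =>
    (measurable_of_countable fun a : Fin (S.α j) => (a : ℕ) * S.place j).comp
      (measurable_pi_apply j)

theorem measurableSet_value_eq (N v : ℕ) : MeasurableSet {x | S.value N x = v} :=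
  measurableSet_eq_fun (S.measurable_value N) measurable_const

theorem measurable_map : Measurable S.map := by
  refine measurable_pi_iff.2 fun n => Measurable.ite ?_ ?_ (measurable_pi_apply n)
  · simp only [Set.ofPred_forall]
    refine MeasurableSet.iInter fun j => MeasurableSet.iInter fun _ => ?_
    exact measurableSet_eq_fun ((measurable_of_countable fun a : Fin (S.α j) => (a : ℕ) + 1).comp
      (measurable_pi_apply j)) measurable_const
  · exact (measurable_of_countable fun a : Fin (S.α n) => (⟨((a : ℕ) + 1) % S.α n,
      Nat.mod_lt _ (lt_of_lt_of_le two_pos (S.two_le n))⟩ : Fin (S.α n))).comp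
      (measurable_pi_apply n)

theorem measurable_setPrefix (N v : ℕ) : Measurable (S.setPrefix N v) := by
  refine measurable_pi_iff.2 fun j => ?_
  unfold setPrefix
  split_ifs
  · exact measurable_const
  · exact measurable_pi_apply j

theorem measure_value_eq (N : ℕ) (a : S.Space) :
    S.measure {x | S.value N x = S.value N a} = ∏ j ∈ Finset.range N, S.ν j {a j} := by
  have : {x | S.value N x = S.value N a} =
      Set.pi (Finset.range N : Set ℕ) fun j => {a j} := by
    ext x
    simp only [Set.mem_ofPred_eq, Set.mem_pi, Finset.mem_coe, Finset.mem_range,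
      Set.mem_singleton_iff]
    refine ⟨fun h => S.eq_of_value_eq h, fun h => Finset.sum_congr rfl fun j hj => ?_⟩
    rw [h j (Finset.mem_range.1 hj)]
  rw [this, measure, Measure.infinitePi_pi _ fun _ _ => MeasurableSet.singleton _]

theorem measure_value_eq_le (N v : ℕ) :
    S.measure {x | S.value N x = v} ≤ ∏ j ∈ Finset.range N, ⨆ a : Fin (S.α j), S.ν j {a} := by
  rcases Set.eq_empty_or_nonempty {x | S.value N x = v} with h | ⟨a, rfl⟩
  · simp [h]
  · rw [measure_value_eq]
    exact Finset.prod_le_prod' fun j _ => le_iSup (fun a => S.ν j {a}) (a j)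

theorem measure_eq_sum_value (N : ℕ) {s : Set S.Space} (hs : MeasurableSet s) :
    S.measure s = ∑ v ∈ Finset.range (S.place N), S.measure ({x | S.value N x = v} ∩ s) := by
  rw [← measure_biUnion_finset]
  · congr 1
    ext x
    simp [S.value_lt N x]
  · intro u _ v _ huv
    refine Set.disjoint_left.2 fun x hx hx' => huv (hx.1.symm.trans hx'.1)
  · exact fun v _ => (S.measurableSet_value_eq N v).inter hs

/-- The first `N` coordinates are independent of the following ones. -/
theorem measure_value_inter_setPrefix (N u v : ℕ) {s : Set S.Space} (hs : MeasurableSet s) :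
    S.measure ({x | S.value N x = u} ∩ S.setPrefix N v ⁻¹' s) =
      S.measure {x | S.value N x = u} * S.measure (S.setPrefix N v ⁻¹' s) := by
  let m : ℕ → MeasurableSpace S.Space := fun j => MeasurableSpace.comap (fun x => x j) inferInstance
  have hind : iIndep m S.measure := by
    exact iIndepFun_infinitePi (P := S.ν) (X := fun j a => a) fun _ => measurable_id
  have hm (j : ℕ) : Measurable[m j] fun x : S.Space => x j := comap_measurable _
  have hle (j : ℕ) : m j ≤ MeasurableSpace.pi := (measurable_pi_apply j).comap_le
  have h := indep_iSup_of_disjoint hle hind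
    (Set.disjoint_left.2 fun j (hj : j ∈ Set.Iio N) (hj' : j ∈ Set.Ici N) =>
      (Set.mem_Iio.1 hj).not_ge hj')
  refine Indep_iff _ _ _ |>.1 h _ _ ?_ ?_
  · have hv : Measurable[⨆ j ∈ Set.Iio N, m j] (S.value N) := by
      refine Finset.measurable_sum _ fun j hj => ?_
      refine (measurable_of_countable fun a : Fin (S.α j) => (a : ℕ) * S.place j).comp ?_
      exact (hm j).mono (le_iSup₂_of_le j (Finset.mem_range.1 hj) le_rfl) le_rfl
    exact hv (MeasurableSet.singleton u)
  · have hv : Measurable[⨆ j ∈ Set.Ici N, m j] (S.setPrefix N v) := by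
      refine (@measurable_pi_iff _ _ _ (⨆ j ∈ Set.Ici N, m j) _ _).2 fun j => ?_
      unfold setPrefix
      split_ifs with hj
      · exact measurable_const
      · exact (hm j).mono (le_iSup₂_of_le j (not_lt.1 hj) le_rfl) le_rfl
    exact hv hs

/-- Two points of `s` with the same coordinates beyond the first `N` are on the same orbit; so if
no point of `s` returns to `s`, the sets obtained from `s` by fixing the first `N` coordinates are
disjoint sets of tails, and `μ s` is at most the largest mass of an `N`-cylinder. -/
theorem conservative (hq : Measure.QuasiMeasurePreserving S.map S.measure S.measure) :
    Conservative S.map S.measure := by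
  refine ⟨hq, fun s hs hs0 => ?_⟩
  by_contra! hret
  refine hs0 (le_antisymm (ge_of_tendsto' S.nonatomic fun N => ?_) zero_le)
  set W := ∏ j ∈ Finset.range N, ⨆ a : Fin (S.α j), S.ν j {a}
  have hdisj : Set.PairwiseDisjoint (↑(Finset.range (S.place N)))
      fun v => S.setPrefix N v ⁻¹' s := by
    have key {u v : ℕ} (huv : u < v) (hv : v < S.place N) (x : S.Space)
        (hu' : S.setPrefix N u x ∈ s) (hv' : S.setPrefix N v x ∈ s) : False := by
      have hu : u < S.place N := huv.trans hv
      refine hret _ hu' (v - u) (by omega) ?_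
      have hval := S.value_setPrefix hu x
      obtain ⟨h1, h2⟩ := S.value_iterate_map (N := N) (n := v - u) (x := S.setPrefix N u x)
        (by omega)
      rwa [← S.setPrefix_eq hv (x := x) (h1.trans (by omega))
        fun j hj => (h2 j hj).trans (S.setPrefix_apply_of_le hj _ _)]
    intro u hu v hv huv
    refine Set.disjoint_left.2 fun x hxu hxv => ?_
    rcases lt_or_gt_of_ne huv with h | h
    · exact key h (Finset.mem_range.1 hv) x hxu hxv
    · exact key h (Finset.mem_range.1 hu) x hxv hxu
  calc S.measure s
      = ∑ v ∈ Finset.range (S.place N), S.measure ({x | S.value N x = v} ∩ s) :=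
        S.measure_eq_sum_value N hs
    _ ≤ ∑ v ∈ Finset.range (S.place N), W * S.measure (S.setPrefix N v ⁻¹' s) := by
        refine Finset.sum_le_sum fun v hv => ?_
        refine le_trans (measure_mono ?_) ((S.measure_value_inter_setPrefix N v v hs).trans_le
          (mul_le_mul_left (S.measure_value_eq_le N v) _))
        rintro x ⟨hxv, hxs⟩
        refine ⟨hxv, ?_⟩
        rwa [Set.mem_preimage, S.setPrefix_eq (Finset.mem_range.1 hv) hxv fun _ _ => rfl]
    _ = W * S.measure (⋃ v ∈ Finset.range (S.place N), S.setPrefix N v ⁻¹' s) := by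
        rw [← Finset.mul_sum, measure_biUnion_finset hdisj
          fun v _ => S.measurable_setPrefix N v hs]
    _ ≤ W := mul_le_of_le_one_right zero_le prob_le_one

theorem prod_le_mul_prod_map {K : ℝ≥0∞}
    (hK : ∀ (N : ℕ) (x : S.Space), (∀ j < N, (x j : ℕ) + 1 = S.α j) → (x N : ℕ) + 1 ≠ S.α N →
      ∏ j ∈ Finset.range (N + 1), S.ν j {x j} ≤
        K * ∏ j ∈ Finset.range (N + 1), S.ν j {S.map x j})
    {N : ℕ} {x : S.Space} (h : ¬∀ j < N, (x j : ℕ) + 1 = S.α j) :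
    ∏ j ∈ Finset.range N, S.ν j {x j} ≤ K * ∏ j ∈ Finset.range N, S.ν j {S.map x j} := by
  induction N with
  | zero => simp at h
  | succ N ih =>
    by_cases hN : ∀ j < N, (x j : ℕ) + 1 = S.α j
    · exact hK N x hN fun e => h fun j hj =>
        (Nat.lt_succ_iff_lt_or_eq.1 hj).elim (hN j) fun e' => e' ▸ e
    · rw [Finset.prod_range_succ, Finset.prod_range_succ, S.map_apply_of_not_forall hN le_rfl,
        ← mul_assoc]
      exact mul_le_mul_left (ih hN) _

/-- To bound the image measure by `K • μ`, it suffices to compare the mass of each cylinder on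
which the odometer carries up to its last coordinate with the mass of its image. -/
theorem map_measure_le {K : ℝ≥0∞}
    (hK : ∀ (N : ℕ) (x : S.Space), (∀ j < N, (x j : ℕ) + 1 = S.α j) → (x N : ℕ) + 1 ≠ S.α N →
      ∏ j ∈ Finset.range (N + 1), S.ν j {x j} ≤
        K * ∏ j ∈ Finset.range (N + 1), S.ν j {S.map x j}) :
    S.measure.map S.map ≤ K • S.measure := by
  refine Measure.le_iff.2 fun s hs => ?_
  rw [Measure.map_apply S.measurable_map hs, Measure.smul_apply, smul_eq_mul]
  have hlim : Tendsto (fun N => K * S.measure s +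
      ∏ j ∈ Finset.range N, ⨆ a : Fin (S.α j), S.ν j {a}) atTop (𝓝 (K * S.measure s)) := by
    simpa using S.nonatomic.const_add (K * S.measure s)
  refine ge_of_tendsto' hlim fun N => ?_
  obtain ⟨P, hP⟩ : ∃ P, S.place N = P + 1 :=
    ⟨S.place N - 1, (Nat.sub_add_cancel (S.place_pos N)).symm⟩
  rw [S.measure_eq_sum_value N (S.measurable_map hs), hP, Finset.sum_range_succ]
  refine add_le_add ?_ ((measure_mono Set.inter_subset_left).trans (S.measure_value_eq_le N P))
  rw [S.measure_eq_sum_value N hs, hP, Finset.sum_range_succ', mul_add, Finset.mul_sum]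
  refine le_add_right (Finset.sum_le_sum fun v hv => ?_)
  have hv : v + 1 < S.place N := by have := Finset.mem_range.1 hv; omega
  have hmass : S.measure {x | S.value N x = v} ≤ K * S.measure {x | S.value N x = v + 1} := by
    rcases Set.eq_empty_or_nonempty {x | S.value N x = v} with h | ⟨a, ha⟩
    · simp [h]
    · have ha : S.value N a = v := ha
      have ha' := S.not_forall_of_value_add_one_lt (N := N) (x := a) (by omega)
      rw [← ha, ← S.value_map_of_not_forall ha', measure_value_eq, measure_value_eq]
      exact S.prod_le_mul_prod_map hK ha'
  calc S.measure ({x | S.value N x = v} ∩ S.map ⁻¹' s)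
      ≤ S.measure ({x | S.value N x = v} ∩ S.setPrefix N (v + 1) ⁻¹' s) := by
        refine measure_mono ?_
        rintro x ⟨hxv, hxs⟩
        have hxv' : S.value N x = v := hxv
        have hx := S.not_forall_of_value_add_one_lt (N := N) (x := x) (by omega)
        refine ⟨hxv, ?_⟩
        rwa [Set.mem_preimage, S.setPrefix_eq hv ((S.value_map_of_not_forall hx).trans (by omega))
          fun j hj => S.map_apply_of_not_forall hx hj]
    _ ≤ K * (S.measure {x | S.value N x = v + 1} * S.measure (S.setPrefix N (v + 1) ⁻¹' s)) := by
        rw [S.measure_value_inter_setPrefix N v (v + 1) hs, ← mul_assoc]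
        exact mul_le_mul_left hmass _
    _ ≤ K * S.measure ({x | S.value N x = v + 1} ∩ s) := by
        rw [← S.measure_value_inter_setPrefix N (v + 1) (v + 1) hs]
        refine mul_le_mul_right (measure_mono ?_) _
        rintro x ⟨hxv, hxs⟩
        refine ⟨hxv, ?_⟩
        rwa [Set.mem_preimage, S.setPrefix_eq hv hxv fun _ _ => rfl] at hxs

theorem measureDense_periodic :
    S.measure.MeasureDense {s | MeasurableSet s ∧ ∃ q, 0 < q ∧ S.map^[q] ⁻¹' s = s} where
  measurable _ h := h.1
  approx s hs hμs ε hε := by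
    have hcyl : S.measure.MeasureDense (measurableCylinders fun n => Fin (S.α n)) :=
      Measure.MeasureDense.of_generateFrom_isSetAlgebra_finite _
        isSetAlgebra_measurableCylinders generateFrom_measurableCylinders.symm
    obtain ⟨t, ht, hst⟩ := hcyl.approx s hs hμs ε hε
    refine ⟨t, ⟨hcyl.measurable t ht, ?_⟩, hst⟩
    obtain ⟨I, A, -, rfl⟩ := (mem_measurableCylinders t).1 ht
    refine ⟨S.place (I.sup id + 1), S.place_pos _, ?_⟩
    ext x
    rw [Set.mem_preimage, mem_cylinder, mem_cylinder]
    have : I.restrict (S.map^[S.place (I.sup id + 1)] x) = I.restrict x :=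
      funext fun j => S.iterate_map_place_apply (Nat.lt_succ_of_le (Finset.le_sup (f := id) j.2)) x
    rw [this]

end Measure

/-! ### Asymptotic singularity of the iterated images -/

section AsymptoticSingularity

/-- The set of points whose coordinates with index in `[m, M)` vanish, for `m ≤ M`. -/
def zeroBlock (m M : ℕ) : Set S.Space := {x | S.value M x < S.place m}

theorem measurableSet_zeroBlock (m M : ℕ) : MeasurableSet (S.zeroBlock m M) :=
  measurableSet_lt (S.measurable_value M) measurable_const

theorem measureReal_zeroBlock_compl_le {m M : ℕ} (hmM : m ≤ M) :
    S.measure.real (S.zeroBlock m M)ᶜ ≤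
      ∑ i ∈ Finset.Ico m M, (S.ν i).real {a | (a : ℕ) ≠ 0} := by
  have hsub : (S.zeroBlock m M)ᶜ ⊆
      ⋃ i ∈ Finset.Ico m M, (fun x : S.Space => x i) ⁻¹' {a | (a : ℕ) ≠ 0} := by
    intro x hx
    by_contra hcon
    simp only [Set.mem_iUnion, not_exists, Finset.mem_Ico, Set.mem_preimage, Set.mem_ofPred_eq,
      not_not] at hcon
    refine hx (lt_of_eq_of_lt ?_ (S.value_lt m x))
    rw [value, value, ← Finset.sum_range_add_sum_Ico _ hmM, Nat.add_eq_left]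
    exact Finset.sum_eq_zero fun i hi => by rw [hcon i (Finset.mem_Ico.1 hi), zero_mul]
  refine (measureReal_mono hsub (measure_ne_top _ _)).trans
    ((measureReal_biUnion_finset_le _ _).trans_eq ?_)
  refine Finset.sum_congr rfl fun i _ => ?_
  rw [measureReal_def, measureReal_def, measure,
    (measurePreserving_eval_infinitePi S.ν i).measure_preimage
      (MeasurableSet.of_discrete).nullMeasurableSet]

/-- Adding `n` to an integer below `place m` gives an integer between `place m` and `place M`,
which has a nonzero digit in `[m, M)`. -/
theorem preimage_iterate_zeroBlock_subset {m M n : ℕ} (h1 : S.place m ≤ n)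
    (h2 : n + S.place m ≤ S.place M) :
    S.map^[n] ⁻¹' S.zeroBlock m M ⊆ (S.zeroBlock m M)ᶜ := by
  intro x hx hx'
  have hx1 : S.value M (S.map^[n] x) < S.place m := hx
  have hx2 : S.value M x < S.place m := hx'
  have := (S.value_iterate_map (N := M) (n := n) (x := x) (by omega)).1
  omega

theorem exists_zeroBlock_tendsto
    (h0 : Tendsto (fun n => (S.ν n).real {a | (a : ℕ) ≠ 0}) atTop (𝓝 0)) :
    ∃ B : ℕ → Set S.Space, (∀ n, MeasurableSet (B n)) ∧
      Tendsto (fun n => S.measure.real (B n)ᶜ) atTop (𝓝 0) ∧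
      Tendsto (fun n => S.measure.real (S.map^[n] ⁻¹' B n)) atTop (𝓝 0) := by
  let m : ℕ → ℕ := fun n => Nat.findGreatest (fun k => S.place k ≤ n) n
  have hle {k n : ℕ} (h : S.place k ≤ n) : k ≤ m n :=
    Nat.le_findGreatest ((S.place_strictMono.id_le k).trans h) h
  have hm1 {n : ℕ} (hn : 1 ≤ n) : S.place (m n) ≤ n :=
    Nat.findGreatest_spec (P := fun k => S.place k ≤ n) (Nat.zero_le n) hn
  have hm2 (n : ℕ) : n < S.place (m n + 1) := by
    by_contra! h
    have := hle h
    omega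
  have hm : Tendsto m atTop atTop :=
    tendsto_atTop.2 fun k => (eventually_ge_atTop (S.place k)).mono fun n hn => hle hn
  have hlim1 : Tendsto (fun n => S.measure.real (S.zeroBlock (m n) (m n + 2))ᶜ) atTop (𝓝 0) := by
    have hlim : Tendsto (fun n => (S.ν (m n)).real {a | (a : ℕ) ≠ 0} +
        (S.ν (m n + 1)).real {a | (a : ℕ) ≠ 0}) atTop (𝓝 0) := by
      simpa using (h0.comp hm).add (h0.comp ((tendsto_add_atTop_nat 1).comp hm))
    refine squeeze_zero (fun _ => measureReal_nonneg) (fun n => ?_) hlim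
    refine (S.measureReal_zeroBlock_compl_le (Nat.le_add_right _ 2)).trans_eq ?_
    rw [Finset.sum_Ico_succ_top (by omega), Finset.sum_Ico_succ_top (by omega), Finset.Ico_self,
      Finset.sum_empty, zero_add]
  refine ⟨fun n => S.zeroBlock (m n) (m n + 2), fun n => S.measurableSet_zeroBlock _ _, hlim1, ?_⟩
  refine squeeze_zero' (Eventually.of_forall fun _ => measureReal_nonneg) ?_ hlim1
  filter_upwards [eventually_ge_atTop 1] with n hn
  refine measureReal_mono (S.preimage_iterate_zeroBlock_subset (hm1 hn) ?_)
  have h1 := S.two_mul_place_le (m n + 1)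
  have h2 := hm2 n
  have h3 := hm1 hn
  change n + S.place (m n) ≤ S.place (m n + 1 + 1)
  omega

theorem exists_zeroBlock_le_ncard
    (h0 : Tendsto (fun n => (S.ν n).real {a | (a : ℕ) ≠ 0}) atTop (𝓝 0)) (r : ℕ) {ε : ℝ}
    (hε : 0 < ε) : ∃ N : ℕ, r < N ∧ ∃ B : Set S.Space, MeasurableSet B ∧
      S.measure.real Bᶜ ≤ ε ∧ (1 - 1 / ((r : ℝ) + 1)) * N ≤
        ((Set.Icc 1 N ∩ {n | S.measure.real (S.map^[n] ⁻¹' B) ≤ ε}).ncard : ℝ) := by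
  have hr2 : (0 : ℝ) < (r : ℝ) + 2 := by positivity
  obtain ⟨m, hm⟩ := eventually_atTop.1 (h0.eventually (gt_mem_nhds (div_pos hε hr2)))
  -- the times `n` in `[place m, N]` are good, and they are a proportion at least `1 - 1 / (r + 1)`
  -- of all times in `[1, N]` because `place M ≥ (r + 2) * place m`
  set M := m + (r + 2) with hM
  have hcompl : S.measure.real (S.zeroBlock m M)ᶜ ≤ ε := by
    refine (S.measureReal_zeroBlock_compl_le (by omega)).trans
      ((Finset.sum_le_card_nsmul _ _ (ε / ((r : ℝ) + 2))
        fun i hi => (hm i (Finset.mem_Ico.1 hi).1).le).trans_eq ?_)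
    rw [Nat.card_Ico, hM, Nat.add_sub_cancel_left, nsmul_eq_mul]
    push_cast
    field_simp
  have hpos := S.place_pos m
  obtain ⟨N, hN⟩ : ∃ N, S.place M = N + S.place m :=
    ⟨S.place M - S.place m, (Nat.sub_add_cancel (S.place_strictMono.monotone (by omega))).symm⟩
  have hNr : (r + 1) * S.place m ≤ N := by
    have h1 := S.two_pow_mul_place_le m (r + 2)
    have h2 : r + 2 ≤ 2 ^ (r + 2) := Nat.lt_two_pow_self.le
    have h3 := Nat.mul_le_mul_right (S.place m) h2
    rw [← hM, hN] at h1
    nlinarith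
  refine ⟨N, by nlinarith, S.zeroBlock m M, S.measurableSet_zeroBlock m M, hcompl, ?_⟩
  have hsub : Set.Icc (S.place m) N ⊆
      Set.Icc 1 N ∩ {n | S.measure.real (S.map^[n] ⁻¹' S.zeroBlock m M) ≤ ε} := fun n hn =>
    ⟨⟨hpos.trans_le hn.1, hn.2⟩, (measureReal_mono
      (S.preimage_iterate_zeroBlock_subset hn.1 (by have := hn.2; omega))).trans hcompl⟩
  have hcard := Set.ncard_le_ncard hsub ((Set.finite_Icc 1 N).inter_of_left _)
  rw [Set.ncard_Icc_nat] at hcard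
  have hcard' : (N : ℝ) ≤ ((Set.Icc 1 N ∩
      {n | S.measure.real (S.map^[n] ⁻¹' S.zeroBlock m M) ≤ ε}).ncard : ℝ) + S.place m := by
    exact_mod_cast (by omega : N ≤ _ + S.place m)
  have hNr' : (S.place m : ℝ) ≤ 1 / ((r : ℝ) + 1) * N := by
    rw [one_div, inv_mul_eq_div, le_div_iff₀ (by positivity), mul_comm]
    exact_mod_cast hNr
  linarith

end AsymptoticSingularity

/-- The operator-theoretic conclusions hold for every odometer whose digits are zero with
probability tending to one and for which the image of `μ` is bounded by a multiple of `μ`. -/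
theorem exists_compositionOperator {c : ℝ≥0∞} (hc : c ≠ ∞)
    (hle : S.measure.map S.map ≤ c • S.measure)
    (h0 : Tendsto (fun n => (S.ν n).real {a | (a : ℕ) ≠ 0}) atTop (𝓝 0))
    (𝕜 : Type*) [RCLike 𝕜] (p : ℝ≥0∞) [Fact (1 ≤ p)] (hp : p ≠ ∞) :
    ∃ T : Lp 𝕜 p S.measure →L[𝕜] Lp 𝕜 p S.measure, IsCompositionOperator S.map T ∧
      IsMixing T ∧ IsDistributionallyChaotic T ∧ IsDevaneyChaotic T ∧
      (2 ≤ p → ¬SatisfiesFHC T) := by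
  have : Fact (p ≠ ∞) := ⟨hp⟩
  have hq := quasiMeasurePreserving_of_map_le S.measurable_map hle
  obtain ⟨T, hT⟩ := exists_isCompositionOperator (𝕜 := 𝕜) S.measurable_map hc hle hp
  have hd : Dense (boundedPeriodic 𝕜 p S.measure S.map : Set (Lp 𝕜 p S.measure)) :=
    dense_boundedPeriodic hp S.measureDense_periodic
  obtain ⟨B, hB, hB1, hB2⟩ := S.exists_zeroBlock_tendsto h0
  have hmix : IsMixing T := hT.isMixing hp hq hd hB hB1 hB2
  exact ⟨T, hT, hmix,
    hT.isDistributionallyChaotic hp hq hd fun r ε hε => S.exists_zeroBlock_le_ncard h0 r hε,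
    ⟨hmix.isHypercyclic, hd.mono fun φ hφ => isPeriodicPt_of_mem_boundedPeriodic hT hq hφ⟩,
    fun hp2 => hT.not_satisfiesFHC hp2 hp (S.conservative hq)⟩

end OdometerSystem

/-! ### The digit laws -/

section Example

/-- The probability of the digit `1` at the index `n`, that is, at the position `n + 1`: it is
`1 / (k + 1)` at the positions `4 ^ k` with `k ≥ 1`, and `2⁻⁽ⁿ⁺¹⁾` elsewhere. -/
noncomputable def oneProb (n : ℕ) : ℝ :=
  if 1 ≤ n ∧ n + 1 = 4 ^ Nat.log 4 (n + 1) then 1 / ((Nat.log 4 (n + 1) : ℝ) + 1)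
  else 1 / 2 ^ (n + 1)

theorem oneProb_of_eq {n k : ℕ} (hk : 1 ≤ k) (h : n + 1 = 4 ^ k) :
    oneProb n = 1 / ((k : ℝ) + 1) := by
  have hlog : Nat.log 4 (n + 1) = k := by rw [h, Nat.log_pow (by norm_num)]
  have h4 : 4 ^ 1 ≤ 4 ^ k := Nat.pow_le_pow_right (by norm_num) hk
  rw [oneProb, hlog, if_pos ⟨by omega, h⟩]

theorem oneProb_of_ne {n : ℕ} (h : ∀ k : ℕ, 1 ≤ k → n + 1 ≠ 4 ^ k) :
    oneProb n = 1 / 2 ^ (n + 1) := by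
  refine if_neg fun ⟨hn, he⟩ => h _ (Nat.one_le_iff_ne_zero.2 fun h0 => ?_) he
  rw [h0] at he
  omega

theorem oneProb_cases (n : ℕ) :
    (∃ k : ℕ, 1 ≤ k ∧ n + 1 = 4 ^ k ∧ oneProb n = 1 / ((k : ℝ) + 1)) ∨
      ((∀ k : ℕ, 1 ≤ k → n + 1 ≠ 4 ^ k) ∧ oneProb n = 1 / 2 ^ (n + 1)) := by
  by_cases h : ∀ k : ℕ, 1 ≤ k → n + 1 ≠ 4 ^ k
  · exact Or.inr ⟨h, oneProb_of_ne h⟩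
  · push Not at h
    obtain ⟨k, hk, hn⟩ := h
    exact Or.inl ⟨k, hk, hn, oneProb_of_eq hk hn⟩

theorem one_div_two_pow_le_oneProb (n : ℕ) : 1 / 2 ^ (n + 1) ≤ oneProb n := by
  rcases oneProb_cases n with ⟨k, hk, hn, h⟩ | ⟨-, h⟩
  · rw [h]
    refine one_div_le_one_div_of_le (by positivity) ?_
    have h1 : k < 4 ^ k := Nat.lt_pow_self (by norm_num)
    have h2 : n + 1 < 2 ^ (n + 1) := Nat.lt_two_pow_self
    exact_mod_cast (by omega : k + 1 ≤ 2 ^ (n + 1))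
  · exact h.ge

theorem oneProb_pos (n : ℕ) : 0 < oneProb n :=
  lt_of_lt_of_le (by positivity) (one_div_two_pow_le_oneProb n)

theorem oneProb_le_half (n : ℕ) : oneProb n ≤ 1 / 2 := by
  rcases oneProb_cases n with ⟨k, hk, -, h⟩ | ⟨-, h⟩
  · rw [h]
    refine one_div_le_one_div_of_le (by norm_num) ?_
    have : (1 : ℝ) ≤ k := by exact_mod_cast hk
    linarith
  · rw [h]
    refine one_div_le_one_div_of_le (by norm_num) ?_
    exact le_self_pow₀ (by norm_num) (by omega)

theorem tendsto_oneProb : Tendsto oneProb atTop (𝓝 0) := by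
  have hlog : Tendsto (fun n => Nat.log 4 (n + 1)) atTop atTop :=
    tendsto_atTop.2 fun k => (eventually_ge_atTop (4 ^ k)).mono fun n hn =>
      (Nat.le_log_iff_pow_le (by norm_num) (by omega)).2 (by omega)
  have h1 : Tendsto (fun n => 1 / ((Nat.log 4 (n + 1) : ℝ) + 1)) atTop (𝓝 0) :=
    tendsto_one_div_add_atTop_nhds_zero_nat.comp hlog
  have h2 : Tendsto (fun n : ℕ => (1 : ℝ) / 2 ^ (n + 1)) atTop (𝓝 0) := by
    have := (tendsto_pow_atTop_nhds_zero_of_lt_one (r := (1 / 2 : ℝ)) (by norm_num)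
      (by norm_num)).comp (tendsto_add_atTop_nat 1)
    simpa [Function.comp_def] using this
  refine squeeze_zero (fun n => (oneProb_pos n).le) (fun n => ?_)
    (by simpa only [add_zero] using h1.add h2)
  unfold oneProb
  split_ifs
  · exact le_add_of_nonneg_right (show (0 : ℝ) ≤ 1 / 2 ^ (n + 1) by positivity)
  · exact le_add_of_nonneg_left
      (show (0 : ℝ) ≤ 1 / ((Nat.log 4 (n + 1) : ℝ) + 1) by positivity)

/-- The partial products telescope along the positions `4 ^ k`. -/
theorem prod_one_sub_oneProb_le (K : ℕ) :
    ∏ n ∈ Finset.range (4 ^ K), (1 - oneProb n) ≤ 1 / ((K : ℝ) + 1) := by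
  have hnn (n : ℕ) : 0 ≤ 1 - oneProb n := by linarith [oneProb_le_half n]
  have hle (n : ℕ) : 1 - oneProb n ≤ 1 := by linarith [oneProb_pos n]
  induction K with
  | zero => simpa using (oneProb_pos 0).le
  | succ K ih =>
    obtain ⟨M, hM⟩ : ∃ M, 4 ^ (K + 1) = M + 1 :=
      ⟨4 ^ (K + 1) - 1, (Nat.sub_add_cancel (Nat.pow_pos four_pos)).symm⟩
    have hKM : 4 ^ K ≤ M := by
      have : 0 < 4 ^ K := by positivity
      rw [pow_succ] at hM
      omega
    rw [hM, Finset.prod_range_succ, oneProb_of_eq (Nat.succ_pos K) hM.symm,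
      ← Finset.prod_range_mul_prod_Ico _ hKM]
    have h1 : ∏ n ∈ Finset.Ico (4 ^ K) M, (1 - oneProb n) ≤ 1 :=
      Finset.prod_le_one (fun n _ => hnn n) fun n _ => hle n
    have h0 : 0 ≤ ∏ n ∈ Finset.range (4 ^ K), (1 - oneProb n) :=
      Finset.prod_nonneg fun n _ => hnn n
    have h2 : (1 : ℝ) - 1 / (((K + 1 : ℕ) : ℝ) + 1) = ((K : ℝ) + 1) / ((K : ℝ) + 2) := by
      push_cast
      field_simp
      ring
    rw [h2]
    have h3 : 1 / (((K + 1 : ℕ) : ℝ) + 1) =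
        1 / ((K : ℝ) + 1) * (((K : ℝ) + 1) / ((K : ℝ) + 2)) := by
      push_cast
      field_simp
      ring
    rw [h3]
    exact mul_le_mul_of_nonneg_right ((mul_le_of_le_one_right h0 h1).trans ih) (by positivity)

/-- The product over the carried digits is controlled by the last or the last but one factor:
two consecutive positions are never both powers of `4`. -/
theorem prod_oneProb_le (N : ℕ) :
    ∏ n ∈ Finset.range N, oneProb n ≤
      8 * ((∏ n ∈ Finset.range N, (1 - oneProb n)) * (1 / 2 ^ (N + 1))) := by
  have hnn (n : ℕ) : 0 ≤ oneProb n := (oneProb_pos n).le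
  have hhalf (n : ℕ) : 1 / 2 ≤ 1 - oneProb n := by linarith [oneProb_le_half n]
  have hle (n : ℕ) : oneProb n ≤ 1 - oneProb n := (oneProb_le_half n).trans (hhalf n)
  have hprod (M : ℕ) : ∏ n ∈ Finset.range M, oneProb n ≤ ∏ n ∈ Finset.range M, (1 - oneProb n) :=
    Finset.prod_le_prod (fun n _ => hnn n) fun n _ => hle n
  have hprod0 (M : ℕ) : 0 ≤ ∏ n ∈ Finset.range M, (1 - oneProb n) :=
    Finset.prod_nonneg fun n _ => (hnn n).trans (hle n)
  -- a factor `2⁻⁽ⁿ⁺¹⁾` at a position which is not a power of `4`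
  have hsmall {n : ℕ} (h : oneProb n = 1 / 2 ^ (n + 1)) :
      oneProb n ≤ 4 * (1 / 2 ^ (n + 2)) * (1 - oneProb n) := by
    have h1 : (1 : ℝ) / 2 ^ (n + 1) = 4 * (1 / 2 ^ (n + 2)) * (1 / 2) := by
      rw [pow_succ _ (n + 1)]
      field_simp
      norm_num
    calc oneProb n = 4 * (1 / 2 ^ (n + 2)) * (1 / 2) := h.trans h1
      _ ≤ _ := mul_le_mul_of_nonneg_left (hhalf n) (by positivity)
  rcases N with _ | N
  · norm_num
  rw [Finset.prod_range_succ, Finset.prod_range_succ]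
  rcases oneProb_cases N with ⟨k, hk, hN, -⟩ | ⟨-, h⟩
  · -- here the position `N` is not a power of `4`
    obtain ⟨M, rfl⟩ : ∃ M, N = M + 1 := by
      refine Nat.exists_eq_succ_of_ne_zero fun h0 => ?_
      have : 4 ^ 1 ≤ 4 ^ k := Nat.pow_le_pow_right (by norm_num) hk
      omega
    have hM : oneProb M = 1 / 2 ^ (M + 1) := by
      refine oneProb_of_ne fun l hl hM => ?_
      have h1 : (4 : ℕ) ∣ 4 ^ k := dvd_pow_self 4 (by omega)
      have h2 : (4 : ℕ) ∣ 4 ^ l := dvd_pow_self 4 (by omega)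
      omega
    rw [Finset.prod_range_succ, Finset.prod_range_succ]
    have h2 : (1 : ℝ) / 2 ^ (M + 2) = 2 * (1 / 2 ^ (M + 1 + 1 + 1)) := by
      rw [pow_succ _ (M + 1 + 1)]
      field_simp
    calc _ ≤ (∏ n ∈ Finset.range M, (1 - oneProb n)) *
          (4 * (1 / 2 ^ (M + 2)) * (1 - oneProb M)) * (1 - oneProb (M + 1)) :=
        mul_le_mul (mul_le_mul (hprod M) (hsmall hM) (hnn M) (hprod0 M)) (hle _) (hnn _)
          (mul_nonneg (hprod0 M) ((hnn M).trans (hsmall hM)))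
      _ = _ := by rw [h2]; ring
  · calc _ ≤ (∏ n ∈ Finset.range N, (1 - oneProb n)) *
          (4 * (1 / 2 ^ (N + 2)) * (1 - oneProb N)) :=
        mul_le_mul (hprod N) (hsmall h) (hnn N) (hprod0 N)
      _ ≤ _ := by
        have : 0 ≤ (∏ n ∈ Finset.range N, (1 - oneProb n)) * (1 - oneProb N) *
            (1 / 2 ^ (N + 2)) :=
          mul_nonneg (mul_nonneg (hprod0 N) ((hnn N).trans (hle N))) (by positivity)
        linarith

/-- The law on `{0, 1}` which gives mass `oneProb n` to `1`. -/
noncomputable def digitLaw (n : ℕ) : Measure (Fin 2) :=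
  ENNReal.ofReal (1 - oneProb n) • Measure.dirac 0 + ENNReal.ofReal (oneProb n) • Measure.dirac 1

theorem digitLaw_zero (n : ℕ) : digitLaw n {0} = ENNReal.ofReal (1 - oneProb n) := by
  simp [digitLaw]

theorem digitLaw_one (n : ℕ) : digitLaw n {1} = ENNReal.ofReal (oneProb n) := by
  simp [digitLaw]

/-- The odometer system on `{0, 1}^ℕ` whose digits have the laws `digitLaw n`. -/
noncomputable def sparseOdometer : OdometerSystem where
  α _ := 2
  two_le _ := le_rfl
  ν n := digitLaw n
  prob n := ⟨by
    have : 0 ≤ 1 - oneProb n := by linarith [oneProb_le_half n]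
    simp [digitLaw, ← ENNReal.ofReal_add this (oneProb_pos n).le]⟩
  pos n := Fin.forall_fin_two.2
    ⟨by rw [digitLaw_zero, ENNReal.ofReal_pos]; linarith [oneProb_le_half n],
      by rw [digitLaw_one, ENNReal.ofReal_pos]; exact oneProb_pos n⟩
  nonatomic := by
    have hnn (n : ℕ) : 0 ≤ 1 - oneProb n := by linarith [oneProb_le_half n]
    have hsup (n : ℕ) : ⨆ a : Fin 2, digitLaw n {a} = ENNReal.ofReal (1 - oneProb n) := by
      refine le_antisymm (iSup_le (Fin.forall_fin_two.2 ⟨(digitLaw_zero n).le, ?_⟩))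
        ((digitLaw_zero n).ge.trans (le_iSup (fun a => digitLaw n {a}) 0))
      rw [digitLaw_one]
      exact ENNReal.ofReal_le_ofReal (by linarith [oneProb_le_half n])
    simp only [hsup]
    have hanti : Antitone fun N => ∏ n ∈ Finset.range N, ENNReal.ofReal (1 - oneProb n) :=
      antitone_nat_of_succ_le fun N => by
        rw [Finset.prod_range_succ]
        exact mul_le_of_le_one_right' (ENNReal.ofReal_le_one.2 (by linarith [oneProb_pos N]))
    have hsub : Tendsto (fun K : ℕ => ∏ n ∈ Finset.range (4 ^ K), ENNReal.ofReal (1 - oneProb n))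
        atTop (𝓝 0) := by
      have hlim := ENNReal.tendsto_ofReal (tendsto_one_div_add_atTop_nhds_zero_nat (𝕜 := ℝ))
      rw [ENNReal.ofReal_zero] at hlim
      refine tendsto_of_tendsto_of_tendsto_of_le_of_le tendsto_const_nhds hlim
        (fun _ => zero_le) fun K => ?_
      rw [← ENNReal.ofReal_prod_of_nonneg fun n _ => hnn n]
      exact ENNReal.ofReal_le_ofReal (prod_one_sub_oneProb_le K)
    have hlim := tendsto_atTop_iInf hanti
    rwa [tendsto_nhds_unique (hlim.comp
      (tendsto_pow_atTop_atTop_of_one_lt (by norm_num : 1 < 4))) hsub] at hlim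

theorem map_sparseOdometer_measure_le :
    sparseOdometer.measure.map sparseOdometer.map ≤ (8 : ℝ≥0∞) • sparseOdometer.measure := by
  refine sparseOdometer.map_measure_le fun N x h hN => ?_
  have hx (j : ℕ) (hj : j < N) : x j = (1 : Fin 2) := Fin.ext (Nat.succ_injective (h j hj))
  have hxN : x N = (0 : Fin 2) := by
    refine Fin.ext ?_
    have h1 : (x N : ℕ) < 2 := (x N).isLt
    have h2 : (x N : ℕ) + 1 ≠ 2 := hN
    change (x N : ℕ) = 0
    omega
  have hy (j : ℕ) (hj : j < N) : sparseOdometer.map x j = (0 : Fin 2) := by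
    rw [OdometerSystem.map, if_pos fun i hi => h i (hi.trans hj)]
    refine Fin.ext ?_
    exact (congrArg (fun a : Fin 2 => ((a : ℕ) + 1) % 2) (hx j hj)).trans
      (by decide : (((1 : Fin 2) : ℕ) + 1) % 2 = 0)
  have hyN : sparseOdometer.map x N = (1 : Fin 2) := by
    rw [OdometerSystem.map, if_pos h]
    refine Fin.ext ?_
    exact (congrArg (fun a : Fin 2 => ((a : ℕ) + 1) % 2) hxN).trans
      (by decide : (((0 : Fin 2) : ℕ) + 1) % 2 = 1)
  have hnn (n : ℕ) : 0 ≤ 1 - oneProb n := by linarith [oneProb_le_half n]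
  have hL : ∏ j ∈ Finset.range (N + 1), sparseOdometer.ν j {x j} =
      ENNReal.ofReal ((∏ j ∈ Finset.range N, oneProb j) * (1 - oneProb N)) := by
    rw [Finset.prod_range_succ, hxN, ENNReal.ofReal_mul (Finset.prod_nonneg
      fun n _ => (oneProb_pos n).le), ENNReal.ofReal_prod_of_nonneg fun n _ => (oneProb_pos n).le]
    refine congrArg₂ _ (Finset.prod_congr rfl fun j hj => ?_) (digitLaw_zero N)
    rw [hx j (Finset.mem_range.1 hj)]
    exact digitLaw_one j
  have hR : ∏ j ∈ Finset.range (N + 1), sparseOdometer.ν j {sparseOdometer.map x j} =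
      ENNReal.ofReal ((∏ j ∈ Finset.range N, (1 - oneProb j)) * oneProb N) := by
    rw [Finset.prod_range_succ, hyN, ENNReal.ofReal_mul (Finset.prod_nonneg
      fun n _ => hnn n), ENNReal.ofReal_prod_of_nonneg fun n _ => hnn n]
    refine congrArg₂ _ (Finset.prod_congr rfl fun j hj => ?_) (digitLaw_one N)
    rw [hy j (Finset.mem_range.1 hj)]
    exact digitLaw_zero j
  have h8 : (8 : ℝ≥0∞) = ENNReal.ofReal 8 := by simp
  rw [hL, hR, h8, ← ENNReal.ofReal_mul (by norm_num)]
  refine ENNReal.ofReal_le_ofReal ?_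
  calc (∏ j ∈ Finset.range N, oneProb j) * (1 - oneProb N)
      ≤ ∏ j ∈ Finset.range N, oneProb j :=
        mul_le_of_le_one_right (Finset.prod_nonneg fun n _ => (oneProb_pos n).le)
          (by linarith [oneProb_pos N])
    _ ≤ 8 * ((∏ j ∈ Finset.range N, (1 - oneProb j)) * (1 / 2 ^ (N + 1))) := prod_oneProb_le N
    _ ≤ 8 * ((∏ j ∈ Finset.range N, (1 - oneProb j)) * oneProb N) :=
        mul_le_mul_of_nonneg_left (mul_le_mul_of_nonneg_left (one_div_two_pow_le_oneProb N)
          (Finset.prod_nonneg fun n _ => hnn n)) (by norm_num)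

theorem tendsto_sparseOdometer_ne_zero :
    Tendsto (fun n => (sparseOdometer.ν n).real {a | (a : ℕ) ≠ 0}) atTop (𝓝 0) := by
  refine tendsto_oneProb.congr fun n => ?_
  have : {a : Fin 2 | (a : ℕ) ≠ 0} = {1} := by ext a; fin_cases a <;> simp
  change oneProb n = (digitLaw n).real {a : Fin 2 | (a : ℕ) ≠ 0}
  rw [this, measureReal_def, digitLaw_one, ENNReal.toReal_ofReal (oneProb_pos n).le]

end Example

end LinearDynamics

theorem theoremD :
    ∃ S : LinearDynamics.OdometerSystem,
      -- the space is `{0,1}^ℕ`, and the marginals are given explicitly (positions are `n + 1`)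
      (∀ n, S.α n = 2) ∧
      (∀ (n : ℕ) (a : Fin (S.α n)), (a : ℕ) = 1 → (∀ k : ℕ, 1 ≤ k → n + 1 ≠ 4 ^ k) →
        S.ν n {a} = ENNReal.ofReal (1 / 2 ^ (n + 1))) ∧
      (∀ (n : ℕ) (a : Fin (S.α n)), (a : ℕ) = 1 → ∀ k : ℕ, 1 ≤ k → n + 1 = 4 ^ k →
        S.ν n {a} = ENNReal.ofReal (1 / ((k : ℝ) + 1))) ∧
      -- the odometer is measurable and non-singular, so composition is well defined on classes
      Measure.QuasiMeasurePreserving S.map S.measure S.measure ∧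
      ∀ (𝕜 : Type) [RCLike 𝕜] (p : ℝ≥0∞) [Fact (1 ≤ p)], p ≠ ∞ →
        ∃ T : Lp 𝕜 p S.measure →L[𝕜] Lp 𝕜 p S.measure,
          LinearDynamics.IsCompositionOperator S.map T ∧
          LinearDynamics.IsMixing T ∧
          LinearDynamics.IsDistributionallyChaotic T ∧
          LinearDynamics.IsDevaneyChaotic T ∧
          (2 ≤ p → ¬ LinearDynamics.SatisfiesFHC T) := by
  have hν (n : ℕ) (a : Fin (LinearDynamics.sparseOdometer.α n)) (ha : (a : ℕ) = 1) :
      LinearDynamics.sparseOdometer.ν n {a} = ENNReal.ofReal (LinearDynamics.oneProb n) := by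
    have : a = (1 : Fin 2) := Fin.ext ha
    rw [this]
    exact LinearDynamics.digitLaw_one n
  refine ⟨LinearDynamics.sparseOdometer, fun _ => rfl, fun n a ha h => ?_,
    fun n a ha k hk h => ?_,
    LinearDynamics.quasiMeasurePreserving_of_map_le LinearDynamics.sparseOdometer.measurable_map
      LinearDynamics.map_sparseOdometer_measure_le, fun 𝕜 _ p _ hp =>
    LinearDynamics.sparseOdometer.exists_compositionOperator ENNReal.ofNat_ne_top
      LinearDynamics.map_sparseOdometer_measure_le LinearDynamics.tendsto_sparseOdometer_ne_zero
      𝕜 p hp⟩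
  · rw [hν n a ha, LinearDynamics.oneProb_of_ne h]
  · rw [hν n a ha, LinearDynamics.oneProb_of_eq hk h]
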